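/- For $n,m\in\mathbb N$ let $\mathcal P(n,m)$ be the class of all (simple) vertex-labelled planar graphs on the vertex set $[n]=\{1,\dots,n\}$ with exactly $m$ edges. Let $m=m(n)$ be such that $m\le n/2+O(n^{2/3})$ (that is, there is a constant $C$ with $m(n)\le n/2+Cn^{2/3}$ for all large $n$) and $2m/n\to c\in[0,1]$ as $n\to\infty$. Let $P=P(n,m)$ be chosen uniformly at random from $\mathcal P(n,m)$ (which is non-empty for all large $n$) and, given $P$, let the root $r=r(n)$ be chosen uniformly at random from the vertices of $P$. Then the (Benjamini–Schramm) local weak limit of $(P,r)$ is the Galton–Watson tree $\mathrm{GWT}(c)$ with offspring distribution $\mathrm{Poisson}(c)$, rooted at its ancestor. That is, for every fixed rooted graph $(H,r_H)$ and every $\ell\in\{1,2,\dots\}$, $$\mathbb P\big[B_\ell(P,r)\cong(H,r_H)\big]\;\longrightarrow\;\mathbb P\big[B_\ell(\mathrm{GWT}(c))\cong(H,r_H)\big]\qquad(n\to\infty),$$ where $B_\ell(G,r)$ denotes the subgraph of $G$ induced on the vertices at distance at most $\ell$ from the root $r$, rooted at $r$, and $\cong$ is isomorphism of graphs that maps root to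 root. -/

import Mathlib

open Filter Topology MeasureTheory ProbabilityTheory

namespace LocalPlanar

noncomputable section

/-! ### Rooted graphs and balls -/

/-- A rooted (simple) graph. -/
structure RootedGraph where
  V : Type
  graph : SimpleGraph V
  root : V

/-- Isomorphism of rooted graphs: a graph isomorphism that takes the root to the root. -/
def RootedGraph.Isomorphic (G H : RootedGraph) : Prop :=
  ∃ φ : G.graph ≃g H.graph, φ G.root = H.root

/-- The ball of radius `ℓ` around the root: the subgraph induced on the vertices at distance at
most `ℓ` from the root, rooted at the same vertex. The extended distance is used, so that
vertices in other components (at distance `⊤`) are excluded. -/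
def RootedGraph.ball (ℓ : ℕ) (G : RootedGraph) : RootedGraph where
  V := {v : G.V // G.graph.edist G.root v ≤ (ℓ : ℕ∞)}
  graph := G.graph.comap Subtype.val
  root := ⟨G.root, by simp⟩

/-! ### Local weak limits -/

/-- The random rooted graph `G₀` (on the probability space `(Ω₀, μ₀)`) is the local weak limit of
the random rooted graphs `G n` (on `(Ω n, μ n)`): for every fixed rooted graph `H` and every
radius `ℓ ≥ 1`, the probability that the ball of radius `ℓ` is isomorphic to `H` converges. -/
def IsLocalWeakLimit {Ω : ℕ → Type} [∀ n, MeasurableSpace (Ω n)]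
    (μ : ∀ n, Measure (Ω n)) (G : ∀ n, Ω n → RootedGraph)
    {Ω₀ : Type} [MeasurableSpace Ω₀] (μ₀ : Measure Ω₀) (G₀ : Ω₀ → RootedGraph) : Prop :=
  ∀ (H : RootedGraph) (ℓ : ℕ), 1 ≤ ℓ →
    Tendsto (fun n => (μ n).real {ω | ((G n ω).ball ℓ).Isomorphic H}) atTop
      (𝓝 (μ₀.real {ω | ((G₀ ω).ball ℓ).Isomorphic H}))

/-! ### The random planar graph -/

/-- A drawing of a graph in the plane without crossings: distinct vertices are distinct points,
every edge is an arc (an injective continuous image of `[0, 1]`) joining its two end vertices,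
and the interior of an arc contains no vertex and meets no other arc. -/
structure PlaneDrawing {V : Type} (G : SimpleGraph V) where
  point : V → EuclideanSpace ℝ (Fin 2)
  arc : G.edgeSet → unitInterval → EuclideanSpace ℝ (Fin 2)
  point_injective : Function.Injective point
  arc_continuous : ∀ e, Continuous (arc e)
  arc_injective : ∀ e, Function.Injective (arc e)
  arc_ends : ∀ e : G.edgeSet, s(arc e 0, arc e 1) = (e : Sym2 V).map point
  arc_ne_point : ∀ (e : G.edgeSet) (t : unitInterval) (v : V), t ≠ 0 → t ≠ 1 → arc e t ≠ point v
  arc_ne_arc : ∀ (e f : G.edgeSet) (s t : unitInterval), e ≠ f → s ≠ 0 → s ≠ 1 → arc e s ≠ arc f t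

/-- A graph is planar if it can be drawn in the plane without crossings. -/
def IsPlanar {V : Type} (G : SimpleGraph V) : Prop := Nonempty (PlaneDrawing G)

/-- The class of all planar graphs with `m` edges on the vertex set `Fin n`. -/
def planarClass (n m : ℕ) : Set (SimpleGraph (Fin n)) :=
  {G | IsPlanar G ∧ G.edgeSet.ncard = m}

/-- The law of `(P, r)`, where `P` is uniform in `planarClass n m` and, given `P`, the root `r` is
uniform among the `n` vertices. (It is the zero measure if there is no such pair; every set
of graphs on `Fin n` is measurable.) -/
def planarLaw (n m : ℕ) : Measure (SimpleGraph (Fin n) × Fin n) :=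
  (uniformOn (planarClass n m)).prod (uniformOn Set.univ)

/-- The rooted graph given by a graph on `Fin n` and one of its vertices. -/
def rootedOfPair (n : ℕ) (p : SimpleGraph (Fin n) × Fin n) : RootedGraph where
  V := Fin n
  graph := p.1
  root := p.2

/-! ### The Galton–Watson tree -/

/-- Individuals are words in `ℕ` (the empty word is the ancestor, and `i :: v` is the `i`-th child
of `v`, counted from `0`), and `X v` is the number of children of `v`.
`IsIndividual X v` says that `v` is in the family tree. -/
def IsIndividual (X : List ℕ → ℕ) : List ℕ → Prop
  | [] => True
  | i :: v => IsIndividual X v ∧ i < X v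

/-- The family tree with offspring numbers `X`, rooted at the ancestor: every individual is joined
by an edge to each of its children. -/
def familyTree (X : List ℕ → ℕ) : RootedGraph where
  V := {v : List ℕ // IsIndividual X v}
  graph := SimpleGraph.fromRel fun u v => ∃ i : ℕ, v.val = i :: u.val
  root := ⟨[], trivial⟩

/-- The law of independent `Poisson(c)` offspring numbers, one for each word; under it
`familyTree` is the Galton–Watson tree with offspring distribution `Poisson(c)`. -/
def offspringLaw (c : NNReal) : Measure (List ℕ → ℕ) :=
  Measure.infinitePi fun _ => poissonMeasure c

end

end LocalPlanar

/-!
A random sequence of `m` edges on `Fin n` is compared with the uniform planar graph by two facts of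
different strength.

* Forests are planar (`isPlanar_of_isAcyclic`), and for `2 m / n → c ≤ 1` the sequence consists of
  the edges of a forest with probability `exp (-o(n))`
  (`eventually_card_le_exp_mul_card_forests`). Indeed, adding edges to a forest one at a time, a
  step loses a factor `1 - O(1 / n)` as long as the mean component size stays bounded, which holds
  up to `(1 - δ) n / 2` edges (`card_linkedForests_le_of_subcritical`), and at most a constant
  factor in the remaining `δ n + o(n)` steps.
* The number of vertices with a given neighbourhood is concentrated on a larger exponential scale:
  it is a Lipschitz function of the sequence (`exists_abs_card_hasType_sub_le`), so that its average
  over an event of probability `exp (-o(n))` is at least its expectation up to `o(n)`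
  (`average_ge_of_lipschitz`, from the exponential moment bound behind McDiarmid's inequality).

So the limit may be computed for the sequence of independent edges. A neighbourhood is described by
the offspring numbers `k` of a plane tree, children being ordered by their labels (`HasType`); a
vertex has at most one type (`HasType.unique`), and the expected proportion of vertices of type `k`
is asymptotically at least the probability `typeProb c k ℓ` that independent Poisson offspring
numbers agree with `k` (`eventually_typeProb_le_average`). The Galton–Watson tree has one of
countably many types, whose probabilities sum to one, so the lower bounds for the types give the
convergence of the law of the ball (`tendsto_ball_isomorphic`). The type records the neighbours of
all vertices at distance at most `ℓ`, but not the edges between vertices at distance `ℓ + 1`: this is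
enough to determine the ball of radius `ℓ`, and makes the count Lipschitz.
-/

namespace LocalPlanar

/-! ### Forests are planar -/

/-- A graph drawn on horizontal levels is planar: `d v` is the level and `x v` the horizontal
position of `v`, edges join consecutive levels, and the lower end of an edge is placed at
`f (x v)`, where `v` is its upper end and `f` is monotone. The edges are then straight segments
which do not cross. -/
theorem isPlanar_of_levels {V : Type} (G : SimpleGraph V) (d x : V → ℕ) (f : ℕ → ℕ)
    (hf : Monotone f) (hx : Function.Injective x)
    (hd : ∀ u v, G.Adj u v → d u + 1 = d v ∨ d v + 1 = d u)
    (hup : ∀ u v, G.Adj u v → d u + 1 = d v → x u = f (x v)) : IsPlanar G := by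
  have hedge : ∀ e : G.edgeSet, ∃ p : V × V, (e : Sym2 V) = s(p.1, p.2) ∧ d p.1 + 1 = d p.2 ∧
      x p.1 = f (x p.2) := by
    rintro ⟨e, he⟩
    induction e using Sym2.ind with
    | _ u v =>
      rw [SimpleGraph.mem_edgeSet] at he
      rcases hd u v he with h | h
      · exact ⟨(u, v), rfl, h, hup _ _ he h⟩
      · exact ⟨(v, u), Sym2.eq_swap, h, hup _ _ he.symm h⟩
  choose p hp1 hp2 hp3 using hedge
  have hp2' : ∀ e, (d (p e).1 : ℝ) + 1 = d (p e).2 := fun e => by exact_mod_cast hp2 e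
  refine ⟨{ point := fun v => !₂[(x v : ℝ), (d v : ℝ)]
            arc := fun e t => !₂[(1 - (t : ℝ)) * x (p e).1 + t * x (p e).2, d (p e).1 + (t : ℝ)]
            point_injective := ?_
            arc_continuous := ?_
            arc_injective := ?_
            arc_ends := ?_
            arc_ne_point := ?_
            arc_ne_arc := ?_ }⟩
  · intro u v h
    have h0 := congrArg (fun z : EuclideanSpace ℝ (Fin 2) => z 0) h
    simp at h0
    exact hx h0
  · intro e
    fun_prop
  · intro e s t h
    have h1 := congrArg (fun z : EuclideanSpace ℝ (Fin 2) => z 1) h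
    exact Subtype.ext (by simpa using h1)
  · intro e
    rw [hp1 e, Sym2.map_mk]
    simp [← hp2' e]
  · intro e t v h0 h1 h
    have h2 := congrArg (fun z : EuclideanSpace ℝ (Fin 2) => z 1) h
    simp only [Matrix.cons_val_one, Matrix.cons_val_fin_one] at h2
    have t0 : (0 : ℝ) < t := unitInterval.pos_iff_ne_zero.2 h0
    have t1 : (t : ℝ) < 1 := unitInterval.lt_one_iff_ne_one.2 h1
    have a : d (p e).1 < d v := by exact_mod_cast (by linarith : (d (p e).1 : ℝ) < d v)
    have b : d v < d (p e).1 + 1 := by exact_mod_cast (by linarith : (d v : ℝ) < d (p e).1 + 1)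
    omega
  · intro e g s t heg h0 h1 h
    have hy := congrArg (fun z : EuclideanSpace ℝ (Fin 2) => z 1) h
    have hz := congrArg (fun z : EuclideanSpace ℝ (Fin 2) => z 0) h
    simp only [Matrix.cons_val_one, Matrix.cons_val_fin_one,
      Matrix.cons_val_zero] at hy hz
    have s0 : (0 : ℝ) < s := unitInterval.pos_iff_ne_zero.2 h0
    have s1 : (s : ℝ) < 1 := unitInterval.lt_one_iff_ne_one.2 h1
    have t0 : (0 : ℝ) ≤ t := t.2.1
    have t1 : (t : ℝ) ≤ 1 := t.2.2
    have a : d (p e).1 < d (p g).1 + 1 := by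
      exact_mod_cast (by linarith : (d (p e).1 : ℝ) < d (p g).1 + 1)
    have b : d (p g).1 < d (p e).1 + 1 := by
      exact_mod_cast (by linarith : (d (p g).1 : ℝ) < d (p e).1 + 1)
    have hde : d (p e).1 = d (p g).1 := by omega
    rw [hde] at hy
    have hst : (t : ℝ) = s := by linarith
    rw [hst] at hz
    -- the two segments lie between the same levels, and keep their order at every height
    have key : ∀ e' g' : G.edgeSet, (1 - (s : ℝ)) * x (p e').1 + s * x (p e').2
        = (1 - (s : ℝ)) * x (p g').1 + s * x (p g').2 → ¬ x (p e').2 < x (p g').2 := by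
      intro e' g' heq hlt
      have h2 : (x (p e').2 : ℝ) < x (p g').2 := by exact_mod_cast hlt
      have h1 : (x (p e').1 : ℝ) ≤ x (p g').1 := by
        rw [hp3, hp3]
        exact_mod_cast hf hlt.le
      nlinarith
    have hxx : x (p e).2 = x (p g).2 :=
      le_antisymm (not_lt.1 (key g e hz.symm)) (not_lt.1 (key e g hz))
    have hl : x (p e).1 = x (p g).1 := by rw [hp3, hp3, hxx]
    apply heg
    apply Subtype.ext
    rw [hp1, hp1, hx hxx, hx hl]

/-- A forest is drawn with the distance to a root of the component as level; the horizontal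
position of a vertex is the number whose base `n` digits are the vertices on its path to the
root, so that the position of the parent is the quotient by `n`. -/
theorem isPlanar_of_isAcyclic {n : ℕ} (G : SimpleGraph (Fin n)) (hG : G.IsAcyclic) :
    IsPlanar G := by
  classical
  let r : Fin n → Fin n := fun v => (G.connectedComponentMk v).out
  have hr : ∀ v, G.Reachable (r v) v := fun v =>
    SimpleGraph.ConnectedComponent.exact (Quot.out_eq (G.connectedComponentMk v))
  have hradj : ∀ u v, G.Adj u v → r u = r v := by
    intro u v h
    simp only [r]
    rw [SimpleGraph.ConnectedComponent.sound h.reachable]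
  let d : Fin n → ℕ := fun v => G.dist (r v) v
  have hd : ∀ u v, G.Adj u v → d u + 1 = d v ∨ d v + 1 = d u := by
    intro u v h
    have := hG.dist_eq_dist_add_one_of_adj_of_reachable (r u) h (hr u)
    simp only [d, ← hradj u v h]
    omega
  have huniq : ∀ u w v, G.Adj u v → G.Adj w v → d u + 1 = d v → d w + 1 = d v → u = w := by
    have hpath : ∀ u v, G.Adj u v → d u + 1 = d v →
        ∃ q : G.Walk (r v) v, q.IsPath ∧ q.penultimate = u := by
      intro u v h hdd
      obtain ⟨q, hq⟩ := (hr u).exists_walk_length_eq_dist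
      have hru := hradj u v h
      refine ⟨(q.concat h).copy hru rfl, ?_, ?_⟩
      · apply SimpleGraph.Walk.isPath_of_length_eq_dist
        simp only [SimpleGraph.Walk.length_copy, SimpleGraph.Walk.length_concat, hq]
        exact hdd
      · have : ∀ (a b c : Fin n) (e : a = b) (q' : G.Walk a c),
            (q'.copy e rfl).penultimate = q'.penultimate := by
          intro a b c e q'
          subst e
          rfl
        rw [this, SimpleGraph.Walk.penultimate_concat]
    intro u w v h h' hu hw
    obtain ⟨q, hq, hqu⟩ := hpath u v h hu
    obtain ⟨q', hq', hqw⟩ := hpath w v h' hw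
    have := (hG.subsingleton_path (r v) v).elim ⟨q, hq⟩ ⟨q', hq'⟩
    rw [← hqu, ← hqw]
    exact congrArg (fun p : G.Path (r v) v => p.val.penultimate) this
  let par : Fin n → Fin n := fun v => if h : ∃ u, G.Adj u v ∧ d u + 1 = d v then h.choose else v
  have hpar : ∀ u v, G.Adj u v → d u + 1 = d v → par v = u := by
    intro u v h hdd
    have hex : ∃ u, G.Adj u v ∧ d u + 1 = d v := ⟨u, h, hdd⟩
    simp only [par, dif_pos hex]
    exact huniq _ _ v hex.choose_spec.1 h hex.choose_spec.2 hdd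
  let xs : ℕ → Fin n → ℕ := fun j => Nat.rec (fun v => (v : ℕ)) (fun _ g v => n * g (par v) + v) j
  have hxs : ∀ j v, xs j v % n = v := by
    intro j v
    cases j with
    | zero => exact Nat.mod_eq_of_lt v.2
    | succ j =>
      show (n * xs j (par v) + v) % n = v
      rw [Nat.mul_add_mod]
      exact Nat.mod_eq_of_lt v.2
  refine isPlanar_of_levels G d (fun v => xs (d v) v) (fun a => a / n) ?_ ?_ hd ?_
  · exact fun a b h => Nat.div_le_div_right h
  · intro u v h
    have := congrArg (· % n) h
    simp only [hxs] at this
    exact Fin.ext this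
  · intro u v h hdd
    show xs (d u) u = xs (d v) v / n
    rw [← hdd]
    show xs (d u) u = (n * xs (d u) (par v) + v) / n
    rw [hpar u v h hdd, Nat.mul_add_div (Fin.pos v), Nat.div_eq_of_lt v.2, add_zero]

/-! ### Counting forests -/

open Classical in
/-- The forests with `k` edges on the vertex set `Fin n`. -/
noncomputable def forests (n k : ℕ) : Finset (SimpleGraph (Fin n)) :=
  Finset.univ.filter fun G => G.IsAcyclic ∧ G.edgeSet.ncard = k

open Classical in
/-- The forests with `k` edges on `Fin n` with an ordered pair of connected (possibly equal)
vertices. -/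
noncomputable def linkedForests (n k : ℕ) : Finset (SimpleGraph (Fin n) × Fin n × Fin n) :=
  Finset.univ.filter fun q => q.1 ∈ forests n k ∧ q.1.Reachable q.2.1 q.2.2

theorem mem_forests {n k : ℕ} {G : SimpleGraph (Fin n)} :
    G ∈ forests n k ↔ G.IsAcyclic ∧ G.edgeSet.ncard = k := by
  simp [forests]

theorem mem_linkedForests {n k : ℕ} {q : SimpleGraph (Fin n) × Fin n × Fin n} :
    q ∈ linkedForests n k ↔ q.1 ∈ forests n k ∧ q.1.Reachable q.2.1 q.2.2 := by
  simp [linkedForests]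

theorem ncard_edgeSet_sup_edge {n : ℕ} {G : SimpleGraph (Fin n)} {x y : Fin n}
    (h : ¬ G.Adj x y) (hxy : x ≠ y) :
    (G ⊔ SimpleGraph.edge x y).edgeSet.ncard = G.edgeSet.ncard + 1 := by
  have h1 : (G ⊔ SimpleGraph.edge x y).edgeSet = insert s(x, y) G.edgeSet := by
    ext e
    induction e using Sym2.ind with
    | _ a b =>
      simp only [SimpleGraph.mem_edgeSet, SimpleGraph.sup_adj, SimpleGraph.edge_adj,
        Set.mem_insert_iff, Sym2.eq_iff]
      grind
  rw [h1, Set.ncard_insert_of_notMem (by simpa using h) (Set.toFinite _)]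

theorem ncard_edgeSet_deleteEdges {n : ℕ} {G : SimpleGraph (Fin n)} {x y : Fin n}
    (h : G.Adj x y) : (G.deleteEdges {s(x, y)}).edgeSet.ncard + 1 = G.edgeSet.ncard := by
  rw [SimpleGraph.edgeSet_deleteEdges]
  exact Set.ncard_sdiff_singleton_add_one (by simpa using h) (Set.toFinite _)

theorem deleteEdges_sup_edge {n : ℕ} {G : SimpleGraph (Fin n)} {x y : Fin n}
    (h : ¬ G.Adj x y) : (G ⊔ SimpleGraph.edge x y).deleteEdges {s(x, y)} = G := by
  ext a b
  simp only [SimpleGraph.deleteEdges_adj, SimpleGraph.sup_adj, SimpleGraph.edge_adj,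
    Set.mem_singleton_iff, Sym2.eq_iff]
  have := G.adj_comm x y
  grind

theorem sup_edge_deleteEdges {n : ℕ} {G : SimpleGraph (Fin n)} {x y : Fin n}
    (h : G.Adj x y) : (G.deleteEdges {s(x, y)}) ⊔ SimpleGraph.edge x y = G := by
  ext a b
  simp only [SimpleGraph.deleteEdges_adj, SimpleGraph.sup_adj, SimpleGraph.edge_adj,
    Set.mem_singleton_iff, Sym2.eq_iff]
  have := G.adj_comm x y
  have := h.ne
  grind

open Classical in
/-- Joining two components of a forest by an edge gives a forest, and the latter with the new edge
determines the former. -/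
theorem card_forests_mul_le (n k : ℕ) :
    n ^ 2 * (forests n k).card ≤
      2 * (k + 1) * (forests n (k + 1)).card + (linkedForests n k).card := by
  let S : Finset (SimpleGraph (Fin n) × Fin n × Fin n) :=
    Finset.univ.filter fun q => q.1 ∈ forests n k ∧ ¬ q.1.Reachable q.2.1 q.2.2
  let T : Finset (SimpleGraph (Fin n) × Fin n × Fin n) :=
    Finset.univ.filter fun q => q.1 ∈ forests n (k + 1) ∧ q.1.Adj q.2.1 q.2.2
  have hS : S.card + (linkedForests n k).card = n ^ 2 * (forests n k).card := by
    have h1 : S ∪ linkedForests n k = forests n k ×ˢ Finset.univ := by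
      ext q
      simp only [S, Finset.mem_union, Finset.mem_filter, Finset.mem_univ, true_and,
        mem_linkedForests, Finset.mem_product]
      tauto
    have h2 : Disjoint S (linkedForests n k) := by
      rw [Finset.disjoint_left]
      intro q hq hq'
      simp only [S, Finset.mem_filter] at hq
      exact hq.2.2 (mem_linkedForests.1 hq').2
    rw [← Finset.card_union_of_disjoint h2, h1, Finset.card_product]
    simp
    ring
  have hT : T.card = 2 * (k + 1) * (forests n (k + 1)).card := by
    have : T.card = ((forests n (k + 1)).sigma fun G : SimpleGraph (Fin n) =>
        (Finset.univ : Finset (Fin n × Fin n)).filter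
          fun p : Fin n × Fin n => G.Adj p.1 p.2).card :=
      Finset.card_nbij' (fun q => ⟨q.1, q.2⟩) (fun s => (s.1, s.2)) (by simp [T, Set.MapsTo])
        (by simp [T, Set.MapsTo]) (fun _ _ => rfl) (fun _ _ => rfl)
    rw [this, Finset.card_sigma, Finset.sum_const_nat (m := 2 * (k + 1))]
    · ring
    · intro G hG
      have h1 := G.dart_card_eq_twice_card_edges
      rw [← Set.ncard_coe_finset, SimpleGraph.coe_edgeFinset, (mem_forests.1 hG).2] at h1
      rw [← h1, ← Fintype.card_subtype]
      exact Fintype.card_congr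
        { toFun := fun p => ⟨p.1, p.2⟩
          invFun := fun d => ⟨d.toProd, d.adj⟩
          left_inv := fun _ => rfl
          right_inv := fun _ => rfl }
  have hST : S.card ≤ T.card := by
    apply Finset.card_le_card_of_injOn (fun q => (q.1 ⊔ SimpleGraph.edge q.2.1 q.2.2, q.2))
    · intro q hq
      simp only [S, Finset.coe_filter, Set.mem_ofPred_eq, Finset.mem_univ, true_and,
        mem_forests] at hq
      have hne : q.2.1 ≠ q.2.2 := fun h => hq.2 (h ▸ SimpleGraph.Reachable.refl _)
      have hadj : ¬ q.1.Adj q.2.1 q.2.2 := fun h => hq.2 h.reachable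
      simp only [T, Finset.coe_filter, Set.mem_ofPred_eq, Finset.mem_univ, true_and, mem_forests]
      refine ⟨⟨hq.1.1.sup_edge_of_not_reachable hq.2, ?_⟩, ?_⟩
      · rw [ncard_edgeSet_sup_edge hadj hne, hq.1.2]
      · simp [SimpleGraph.edge_adj, hne]
    · intro q hq q' hq' h
      simp only [S, Finset.coe_filter, Set.mem_ofPred_eq, Finset.mem_univ, true_and] at hq hq'
      simp only [Prod.mk.injEq] at h
      have hadj : ¬ q.1.Adj q.2.1 q.2.2 := fun h => hq.2 h.reachable
      have hadj' : ¬ q'.1.Adj q'.2.1 q'.2.2 := fun h => hq'.2 h.reachable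
      refine Prod.ext ?_ h.2
      rw [← deleteEdges_sup_edge hadj, ← deleteEdges_sup_edge hadj', h.1, h.2]
  omega

open Classical in
/-- The first edge of the path between two connected vertices of a forest may be removed. -/
theorem card_linkedForests_succ_le (n k : ℕ) :
    (linkedForests n (k + 1)).card ≤
      n * (forests n (k + 1)).card + n * (linkedForests n k).card := by
  have h : ∀ q ∈ linkedForests n (k + 1), q.2.1 ≠ q.2.2 → ∃ z, q.1.Adj q.2.1 z ∧
      (q.1.deleteEdges {s(q.2.1, z)}, z, q.2.2) ∈ linkedForests n k := by
    rintro ⟨G, x, y⟩ hq hne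
    obtain ⟨hG, hxy⟩ := mem_linkedForests.1 hq
    obtain ⟨hac, hcard⟩ := mem_forests.1 hG
    obtain ⟨p, hp⟩ := hxy.exists_isPath
    cases p with
    | nil => exact absurd rfl hne
    | @cons _ z _ hadj p =>
      refine ⟨z, hadj, mem_linkedForests.2 ⟨mem_forests.2 ⟨?_, ?_⟩, ?_⟩⟩
      · exact hac.anti (SimpleGraph.deleteEdges_le _)
      · have := ncard_edgeSet_deleteEdges hadj
        simp only at this hcard ⊢
        omega
      · have hx := ((SimpleGraph.Walk.cons_isPath_iff _ _).1 hp).2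
        refine ⟨p.toDeleteEdge s(x, z) fun he => hx ?_⟩
        exact p.fst_mem_support_of_mem_edges he
  have h' : ∀ q : SimpleGraph (Fin n) × Fin n × Fin n, ∃ z, q ∈ linkedForests n (k + 1) →
      q.2.1 ≠ q.2.2 → q.1.Adj q.2.1 z ∧
      (q.1.deleteEdges {s(q.2.1, z)}, z, q.2.2) ∈ linkedForests n k := by
    intro q
    by_cases hq : q ∈ linkedForests n (k + 1) ∧ q.2.1 ≠ q.2.2
    · obtain ⟨z, hz⟩ := h q hq.1 hq.2
      exact ⟨z, fun _ _ => hz⟩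
    · exact ⟨q.2.1, fun h1 h2 => absurd ⟨h1, h2⟩ hq⟩
  choose z hz using h'
  let f : SimpleGraph (Fin n) × Fin n × Fin n →
      (Fin n × SimpleGraph (Fin n)) ⊕ (Fin n × SimpleGraph (Fin n) × Fin n × Fin n) := fun q =>
    if q.2.1 = q.2.2 then .inl (q.2.1, q.1)
    else .inr (q.2.1, q.1.deleteEdges {s(q.2.1, z q)}, z q, q.2.2)
  have hcard := Finset.card_le_card_of_injOn (s := linkedForests n (k + 1))
    (t := (Finset.univ ×ˢ forests n (k + 1)).disjSum (Finset.univ ×ˢ linkedForests n k)) f ?_ ?_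
  · simpa [Finset.card_disjSum, Finset.card_product] using hcard
  · intro q hq
    simp only [f]
    split_ifs with h
    · simpa using (mem_linkedForests.1 hq).1
    · simpa using (hz q hq h).2
  · intro q hq q' hq' heq
    simp only [f] at heq
    split_ifs at heq with h h' h'
    · simp only [Sum.inl.injEq, Prod.mk.injEq] at heq
      refine Prod.ext heq.2 (Prod.ext heq.1 ?_)
      rw [← h, ← h', heq.1]
    · simp only [Sum.inr.injEq, Prod.mk.injEq] at heq
      obtain ⟨h1, h2, h3, h4⟩ := heq
      refine Prod.ext ?_ (Prod.ext h1 h4)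
      rw [← sup_edge_deleteEdges (hz q hq h).1, ← sup_edge_deleteEdges (hz q' hq' h').1, h2, h1, h3]

open Classical in
/-- In a graph with `k` edges every component has at most `k + 1` vertices. -/
theorem card_linkedForests_le (n k : ℕ) :
    (linkedForests n k).card ≤ n * (k + 1) * (forests n k).card := by
  have hcomp : ∀ G ∈ forests n k, ∀ x : Fin n,
      (Finset.univ.filter fun y => G.Reachable x y).card ≤ k + 1 := by
    intro G hG x
    have h1 := (G.connectedComponentMk x).connected_toSimpleGraph.card_vert_le_card_edgeSet_add_one
    have h2 : Nat.card (G.connectedComponentMk x).toSimpleGraph.edgeSet ≤ G.edgeSet.ncard := by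
      rw [← Nat.card_coe_set_eq]
      exact Nat.card_le_card_of_injective _
        (SimpleGraph.Embedding.mapEdgeSet (SimpleGraph.Embedding.induce _)).injective
    rw [(mem_forests.1 hG).2] at h2
    refine le_trans (le_of_eq ?_) (h1.trans (Nat.add_le_add_right h2 1))
    rw [← Fintype.card_subtype, ← Nat.card_eq_fintype_card]
    refine Nat.card_congr (Equiv.subtypeEquivRight fun y => ?_)
    exact ⟨fun h => SimpleGraph.ConnectedComponent.sound h.symm,
      fun h => (SimpleGraph.ConnectedComponent.exact h).symm⟩
  have : linkedForests n k ⊆ ((forests n k).sigma fun G => (Finset.univ : Finset (Fin n)).sigma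
      fun x => Finset.univ.filter fun y => G.Reachable x y).image fun s => (s.1, s.2.1, s.2.2) := by
    intro q hq
    simp only [Finset.mem_image, Finset.mem_sigma, Finset.mem_univ, Finset.mem_filter, true_and]
    exact ⟨⟨q.1, q.2.1, q.2.2⟩, mem_linkedForests.1 hq, rfl⟩
  refine (Finset.card_le_card this).trans (Finset.card_image_le.trans ?_)
  rw [Finset.card_sigma, mul_comm _ (forests n k).card]
  refine Finset.sum_le_card_nsmul _ _ _ fun G hG => ?_
  rw [Finset.card_sigma]
  refine (Finset.sum_le_card_nsmul _ _ _ fun x _ => hcomp G hG x).trans ?_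
  simp

/-- Up to `(1 - δ) n / 2` edges, the mean component size (seen from a random vertex) of a random
forest is at most `2 / δ`. -/
theorem card_linkedForests_le_of_subcritical {n : ℕ} {δ : ℝ} (hδ : 0 < δ) (hδ1 : δ < 1)
    (hn : 2 / δ * (1 + δ / 2) ≤ n * (δ / 2)) (k : ℕ) (hk : 2 * (k : ℝ) ≤ (1 - δ) * n) :
    ((linkedForests n k).card : ℝ) ≤ 2 / δ * n * (forests n k).card := by
  have hK : 2 / δ * δ = 2 := by field_simp
  set K : ℝ := 2 / δ with hKdef
  have hK1 : 1 ≤ K := by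
    rw [hKdef, le_div_iff₀ hδ]
    linarith
  have hn0 : (0 : ℝ) < n := by
    by_contra h
    have : (n : ℝ) = 0 := le_antisymm (not_lt.1 h) n.cast_nonneg
    rw [this] at hn
    nlinarith
  induction k with
  | zero =>
    have h := card_linkedForests_le n 0
    have h' : ((linkedForests n 0).card : ℝ) ≤ n * (0 + 1) * (forests n 0).card := by
      exact_mod_cast h
    refine h'.trans ?_
    rw [zero_add, mul_one]
    gcongr
    nlinarith
  | succ k ih =>
    push_cast at hk
    have hR := ih (by linarith)
    have h1 : (n : ℝ) ^ 2 * (forests n k).card ≤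
        2 * (k + 1) * (forests n (k + 1)).card + (linkedForests n k).card := by
      exact_mod_cast card_forests_mul_le n k
    have h2 : ((linkedForests n (k + 1)).card : ℝ) ≤
        n * (forests n (k + 1)).card + n * (linkedForests n k).card := by
      exact_mod_cast card_linkedForests_succ_le n k
    set F : ℝ := ((forests n k).card : ℝ)
    set F' : ℝ := ((forests n (k + 1)).card : ℝ)
    have hF : 0 ≤ F := Nat.cast_nonneg _
    have hF' : 0 ≤ F' := Nat.cast_nonneg _
    have h3 : n * ((n - K) * F) ≤ n * ((1 - δ) * F') := by
      have : 2 * ((k : ℝ) + 1) * F' ≤ (1 - δ) * n * F' := by gcongr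
      nlinarith
    have h4 : (n - K) * F ≤ (1 - δ) * F' := le_of_mul_le_mul_left h3 hn0
    have h5 : n * F ≤ (1 + δ / 2) * ((n - K) * F) := by nlinarith
    have h6 : n * F ≤ (1 - δ / 2) * F' := by
      have : (1 + δ / 2) * ((n - K) * F) ≤ (1 + δ / 2) * ((1 - δ) * F') := by gcongr
      nlinarith [mul_nonneg (mul_nonneg hδ.le hδ.le) hF']
    calc ((linkedForests n (k + 1)).card : ℝ) ≤ n * F' + n * (linkedForests n k).card := h2
      _ ≤ n * F' + n * (K * n * F) := by gcongr
      _ = n * F' + n * K * (n * F) := by ring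
      _ ≤ n * F' + n * K * ((1 - δ / 2) * F') := by gcongr
      _ = K * n * F' := by linear_combination (-(n * F') / 2) * hK

/-- The number of forests compared with `n ^ (2 * m) / (2 ^ m * m !)`: an edge costs a factor
`1 - O(1 / n)` in the subcritical range, and a constant factor after it. -/
theorem pow_le_exp_mul_card_forests {n : ℕ} {δ : ℝ} (hδ : 0 < δ) (hδ1 : δ < 1)
    (hn : 2 / δ * (1 + δ / 2) ≤ n * (δ / 2)) (m : ℕ) (hm : 4 * m ≤ 3 * n) :
    ((n : ℝ) ^ 2) ^ m ≤ Real.exp (2 * (2 / δ) / n * m + 2 * max 0 (m - (1 - δ) * n / 2)) *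
      (2 ^ m * m.factorial * (forests n m).card) := by
  have hKn : 2 * (2 / δ) ≤ n := by
    have h1 : 0 < 2 / δ := by positivity
    nlinarith
  induction m with
  | zero =>
    have : (⊥ : SimpleGraph (Fin n)) ∈ forests n 0 := by
      rw [mem_forests]
      exact ⟨SimpleGraph.isAcyclic_bot, by simp⟩
    have h1 : (1 : ℝ) ≤ (forests n 0).card := by
      exact_mod_cast Finset.card_pos.2 ⟨_, this⟩
    have h2 : 1 ≤ Real.exp (2 * (2 / δ) / n * (0 : ℕ) +
        2 * max 0 (((0 : ℕ) : ℝ) - (1 - δ) * n / 2)) := by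
      exact Real.one_le_exp (by positivity)
    simp only [pow_zero, Nat.factorial_zero, Nat.cast_one, one_mul]
    nlinarith
  | succ k ih =>
    have hk := ih (by omega)
    have hn0 : (0 : ℝ) < n := by exact_mod_cast (by omega : 0 < n)
    have h1 : (n : ℝ) ^ 2 * (forests n k).card ≤
        2 * (k + 1) * (forests n (k + 1)).card + (linkedForests n k).card := by
      exact_mod_cast card_forests_mul_le n k
    set K : ℝ := 2 / δ with hKdef
    have hKpos : 0 < K := by positivity
    set F : ℝ := ((forests n k).card : ℝ)
    set F' : ℝ := ((forests n (k + 1)).card : ℝ)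
    have hF : 0 ≤ F := Nat.cast_nonneg _
    have hF' : 0 ≤ F' := Nat.cast_nonneg _
    set b : ℕ → ℝ := fun j => 2 * K / n * j + 2 * max 0 (j - (1 - δ) * n / 2) with hb
    have hstep : (n : ℝ) ^ 2 * F ≤ Real.exp (b (k + 1) - b k) * (2 * (k + 1) * F') := by
      by_cases hsub : 2 * (k : ℝ) ≤ (1 - δ) * n
      · have hR := card_linkedForests_le_of_subcritical hδ hδ1 hn k hsub
        have hx : 1 ≤ Real.exp (2 * K / n) * (1 - K / n) := by
          have e1 := Real.add_one_le_exp (2 * K / n)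
          have e2 : K / n ≤ 1 / 2 := by
            rw [div_le_iff₀ hn0]
            linarith
          have e3 : 0 < K / n := by positivity
          have e4 : 2 * K / n = 2 * (K / n) := by ring
          rw [e4] at e1 ⊢
          nlinarith
        have hle : Real.exp (2 * K / n) ≤ Real.exp (b (k + 1) - b k) := by
          apply Real.exp_le_exp.2
          have : max 0 ((k : ℝ) - (1 - δ) * n / 2) ≤ max 0 (((k + 1 : ℕ) : ℝ) - (1 - δ) * n / 2) :=
            max_le_max le_rfl (by push_cast; linarith)
          simp only [hb]
          push_cast at this ⊢
          linarith
        calc (n : ℝ) ^ 2 * F ≤ (n : ℝ) ^ 2 * F * (Real.exp (2 * K / n) * (1 - K / n)) := by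
              nlinarith [mul_nonneg (sq_nonneg (n : ℝ)) hF]
          _ = Real.exp (2 * K / n) * ((n : ℝ) ^ 2 * F - K * n * F) := by
              field_simp
          _ ≤ Real.exp (2 * K / n) * (2 * (k + 1) * F') := by
              gcongr
              linarith
          _ ≤ _ := by gcongr
      · have hR : ((linkedForests n k).card : ℝ) ≤ n * (k + 1) * F := by
          have h := (Nat.cast_le (α := ℝ)).2 (card_linkedForests_le n k)
          push_cast at h
          exact h
        have hk4 : 4 * ((k : ℝ) + 1) ≤ 3 * n := by exact_mod_cast hm
        have hle : 4 ≤ Real.exp (b (k + 1) - b k) := by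
          have e1 : (2 : ℝ) ≤ Real.exp 1 := by
            have := Real.add_one_le_exp (1 : ℝ)
            linarith
          have e2 : Real.exp 2 = Real.exp 1 * Real.exp 1 := by
            rw [← Real.exp_add]
            norm_num
          have e3 : (2 : ℝ) ≤ b (k + 1) - b k := by
            simp only [hb]
            push_cast
            rw [max_eq_right (by linarith), max_eq_right (by linarith)]
            have : 0 < 2 * K / n := by positivity
            nlinarith
          have := Real.exp_le_exp.2 e3
          nlinarith
        have h3 : (n : ℝ) ^ 2 * F ≤ 4 * (2 * (k + 1) * F') := by
          have : n * (4 * ((k : ℝ) + 1)) * F ≤ n * (3 * n) * F := by gcongr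
          nlinarith
        refine h3.trans ?_
        gcongr
    have hfin : Real.exp (b (k + 1)) = Real.exp (b k) * Real.exp (b (k + 1) - b k) := by
      rw [← Real.exp_add]
      ring_nf
    show ((n : ℝ) ^ 2) ^ (k + 1) ≤ Real.exp (b (k + 1)) * _
    rw [hfin, pow_succ, Nat.factorial_succ, pow_succ]
    push_cast
    calc ((n : ℝ) ^ 2) ^ k * (n : ℝ) ^ 2
        ≤ (Real.exp (b k) * (2 ^ k * k.factorial * F)) * (n : ℝ) ^ 2 := by gcongr
      _ = (Real.exp (b k) * (2 ^ k * k.factorial)) * ((n : ℝ) ^ 2 * F) := by ring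
      _ ≤ (Real.exp (b k) * (2 ^ k * k.factorial)) *
          (Real.exp (b (k + 1) - b k) * (2 * (k + 1) * F')) := by gcongr
      _ = _ := by ring

/-- If `2 m / n → c ≤ 1`, then a random sequence of `m` edges consists of the edges of a forest
with probability at least `exp (-ε n)`. -/
theorem eventually_card_le_exp_mul_card_forests (m : ℕ → ℕ) (c : ℝ) (hc : c ≤ 1)
    (hlim : Tendsto (fun n : ℕ => 2 * (m n : ℝ) / (n : ℝ)) atTop (𝓝 c)) (ε : ℝ) (hε : 0 < ε) :
    ∀ᶠ n : ℕ in atTop, (((n + 1).choose 2 : ℕ) : ℝ) ^ m n ≤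
      Real.exp (ε * n) * ((m n).factorial * (forests n (m n)).card) := by
  obtain ⟨δ, hδ, hδ2, hδε⟩ : ∃ δ : ℝ, 0 < δ ∧ δ ≤ 1 / 4 ∧ δ ≤ ε / 8 :=
    ⟨min (1 / 4) (ε / 8), by positivity, min_le_left _ _, min_le_right _ _⟩
  have hlt : ∀ᶠ n : ℕ in atTop, 2 * (m n : ℝ) / (n : ℝ) < 1 + δ :=
    hlim.eventually_lt_const (by linarith)
  have hbig : ∀ᶠ n : ℕ in atTop,
      (max (2 / δ * (1 + δ / 2) / (δ / 2)) ((2 * (2 / δ) + 1) / (ε / 2))) ≤ (n : ℝ) :=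
    tendsto_natCast_atTop_atTop.eventually_ge_atTop _
  filter_upwards [hlt, hbig, eventually_gt_atTop 0] with n h1 h2 hn
  have hn0 : (0 : ℝ) < n := by exact_mod_cast hn
  rw [div_lt_iff₀ hn0] at h1
  have h3 := (le_max_left _ _).trans h2
  have h4 := (le_max_right _ _).trans h2
  rw [div_le_iff₀ (by positivity)] at h3 h4
  have hm : 4 * m n ≤ 3 * n := by
    have : 4 * (m n : ℝ) ≤ 3 * n := by nlinarith
    exact_mod_cast this
  have hmn : (m n : ℝ) ≤ n := by exact_mod_cast (by omega : m n ≤ n)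
  have key := pow_le_exp_mul_card_forests hδ (by linarith) h3 (m n) hm
  have hexp : 2 * (2 / δ) / n * m n + 2 * max 0 (m n - (1 - δ) * n / 2) + (m n : ℝ) / n
      ≤ ε * n := by
    have e1 : max 0 (m n - (1 - δ) * n / 2) ≤ δ * n :=
      max_le (by positivity) (by linarith)
    have e2 : (m n : ℝ) / n ≤ 1 := by
      rw [div_le_one hn0]
      exact hmn
    have e3 : 2 * (2 / δ) / n * m n = 2 * (2 / δ) * (m n / n) := by ring
    have e4 : 2 * (2 / δ) * (m n / n) ≤ 2 * (2 / δ) * 1 := by gcongr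
    rw [e3]
    nlinarith
  have hch : (((n + 1).choose 2 : ℕ) : ℝ) = (n : ℝ) ^ 2 * (1 + 1 / n) / 2 := by
    rw [Nat.cast_choose_two]
    push_cast
    field_simp
    ring
  have hone : (1 + 1 / (n : ℝ)) ^ m n ≤ Real.exp ((m n : ℝ) / n) := by
    have : 1 + 1 / (n : ℝ) ≤ Real.exp (1 / n) := by
      have := Real.add_one_le_exp (1 / (n : ℝ))
      linarith
    calc (1 + 1 / (n : ℝ)) ^ m n ≤ Real.exp (1 / n) ^ m n := by gcongr
      _ = Real.exp ((m n : ℝ) / n) := by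
        rw [← Real.exp_nat_mul]
        ring_nf
  rw [hch, div_pow, mul_pow, div_le_iff₀ (by positivity)]
  calc ((n : ℝ) ^ 2) ^ m n * (1 + 1 / (n : ℝ)) ^ m n
      ≤ (Real.exp (2 * (2 / δ) / n * m n + 2 * max 0 (m n - (1 - δ) * n / 2)) *
        (2 ^ m n * (m n).factorial * (forests n (m n)).card)) * Real.exp ((m n : ℝ) / n) := by
        gcongr
    _ = Real.exp (2 * (2 / δ) / n * m n + 2 * max 0 (m n - (1 - δ) * n / 2) + (m n : ℝ) / n) *
        (2 ^ m n * (m n).factorial * (forests n (m n)).card) := by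
        rw [Real.exp_add _ ((m n : ℝ) / n)]
        ring
    _ ≤ Real.exp (ε * n) * (2 ^ m n * (m n).factorial * (forests n (m n)).card) := by
        gcongr
    _ = _ := by ring

/-! ### Averages of Lipschitz functions over large subsets of a product space -/

theorem sum_exp_neg_le {E : Type*} [Fintype E] [Nonempty E] (h : E → ℝ) (L : ℝ) (hL : L ≤ 1)
    (hlip : ∀ x y, |h x - h y| ≤ L) :
    ∑ x, Real.exp (-h x) ≤
      Fintype.card E * Real.exp (-((∑ x, h x) / Fintype.card E) + L ^ 2) := by
  have hc : (0 : ℝ) < Fintype.card E := by exact_mod_cast Fintype.card_pos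
  set a : ℝ := (∑ x, h x) / Fintype.card E with ha
  have hsum : ∑ x, (h x - a) = 0 := by
    rw [Finset.sum_sub_distrib, Finset.sum_const, Finset.card_univ, nsmul_eq_mul, ha]
    field_simp
    ring
  have hdev : ∀ x, |h x - a| ≤ L := by
    intro x
    have h1 : h x - a = (∑ y, (h x - h y)) / Fintype.card E := by
      rw [Finset.sum_sub_distrib, Finset.sum_const, Finset.card_univ, nsmul_eq_mul, ha]
      field_simp
    rw [h1, abs_div, abs_of_pos hc, div_le_iff₀ hc]
    refine (Finset.abs_sum_le_sum_abs _ _).trans ?_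
    refine (Finset.sum_le_card_nsmul _ _ L fun y _ => hlip x y).trans ?_
    rw [Finset.card_univ, nsmul_eq_mul, mul_comm]
  have hterm : ∀ x, Real.exp (-h x) ≤ Real.exp (-a) * (1 + L ^ 2 - (h x - a)) := by
    intro x
    have h1 : Real.exp (-h x) = Real.exp (-a) * Real.exp (-(h x - a)) := by
      rw [← Real.exp_add]
      ring_nf
    rw [h1]
    gcongr
    have h2 := Real.abs_exp_sub_one_sub_id_le (x := -(h x - a))
      (by rw [abs_neg]; exact (hdev x).trans hL)
    have h3 := (abs_le.1 h2).2
    have h4 := sq_le_sq' (neg_le_of_abs_le (hdev x)) (le_of_abs_le (hdev x))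
    nlinarith
  calc ∑ x, Real.exp (-h x) ≤ ∑ x, Real.exp (-a) * (1 + L ^ 2 - (h x - a)) :=
        Finset.sum_le_sum fun x _ => hterm x
    _ = Real.exp (-a) * (Fintype.card E * (1 + L ^ 2)) := by
        rw [← Finset.mul_sum, Finset.sum_sub_distrib, hsum, Finset.sum_const, Finset.card_univ,
          nsmul_eq_mul, sub_zero]
    _ ≤ Real.exp (-a) * (Fintype.card E * Real.exp (L ^ 2)) := by
        gcongr
        rw [add_comm]
        exact Real.add_one_le_exp _
    _ = _ := by
        rw [Real.exp_add]
        ring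

/-- The exponential moment bound behind McDiarmid's inequality. -/
theorem sum_exp_neg_le_of_lipschitz {E : Type*} [Fintype E] [Nonempty E] (L : ℝ) (hL : L ≤ 1) :
    ∀ (m : ℕ) (f : (Fin m → E) → ℝ),
      (∀ ω i e, |f (Function.update ω i e) - f ω| ≤ L) →
      ∑ ω, Real.exp (-f ω) ≤ (Fintype.card E : ℝ) ^ m *
        Real.exp (-((∑ ω, f ω) / (Fintype.card E : ℝ) ^ m) + L ^ 2 * m) := by
  have hc : (0 : ℝ) < Fintype.card E := by exact_mod_cast Fintype.card_pos
  intro m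
  induction m with
  | zero =>
    intro f _
    simp
  | succ m ih =>
    intro f hf
    have hsplit : ∀ F : (Fin (m + 1) → E) → ℝ,
        ∑ ω, F ω = ∑ x, ∑ ω : Fin m → E, F (Fin.cons x ω) := by
      intro F
      rw [← Fintype.sum_prod_type']
      exact (Fintype.sum_equiv (Fin.consEquiv fun _ => E) _ _ fun _ => rfl).symm
    set h : E → ℝ := fun x => (∑ ω : Fin m → E, f (Fin.cons x ω)) / (Fintype.card E : ℝ) ^ m
      with hh
    have h1 : ∀ x, ∑ ω : Fin m → E, Real.exp (-f (Fin.cons x ω)) ≤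
        (Fintype.card E : ℝ) ^ m * Real.exp (-h x + L ^ 2 * m) := by
      intro x
      refine ih (fun ω => f (Fin.cons x ω)) fun ω i e => ?_
      rw [Fin.cons_update]
      exact hf _ _ _
    have h2 : ∀ x y, |h x - h y| ≤ L := by
      intro x y
      simp only [hh]
      rw [← sub_div, abs_div, abs_of_pos (pow_pos hc m), div_le_iff₀ (pow_pos hc m),
        ← Finset.sum_sub_distrib]
      refine (Finset.abs_sum_le_sum_abs _ _).trans ?_
      refine (Finset.sum_le_card_nsmul _ _ L fun ω _ => ?_).trans ?_
      · have h0 : (Fin.cons x ω : Fin (m + 1) → E) = Function.update (Fin.cons y ω) 0 x :=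
          (Fin.update_cons_zero (α := fun _ => E) y ω x).symm
        rw [h0]
        exact hf _ _ _
      · rw [Finset.card_univ, nsmul_eq_mul, mul_comm, Fintype.card_fun, Fintype.card_fin]
        push_cast
        exact le_rfl
    have h3 := sum_exp_neg_le h L hL h2
    have h4 : (∑ x, h x) / (Fintype.card E : ℝ) =
        (∑ ω, f ω) / (Fintype.card E : ℝ) ^ (m + 1) := by
      rw [hsplit f, hh, ← Finset.sum_div, div_div, pow_succ]
    rw [hsplit]
    calc ∑ x, ∑ ω : Fin m → E, Real.exp (-f (Fin.cons x ω))
        ≤ ∑ x, (Fintype.card E : ℝ) ^ m * Real.exp (-h x + L ^ 2 * m) :=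
          Finset.sum_le_sum fun x _ => h1 x
      _ = (Fintype.card E : ℝ) ^ m * Real.exp (L ^ 2 * m) * ∑ x, Real.exp (-h x) := by
          rw [Finset.mul_sum]
          refine Finset.sum_congr rfl fun x _ => ?_
          rw [Real.exp_add]
          ring
      _ ≤ (Fintype.card E : ℝ) ^ m * Real.exp (L ^ 2 * m) * (Fintype.card E *
          Real.exp (-((∑ x, h x) / Fintype.card E) + L ^ 2)) := by gcongr
      _ = _ := by
          have h5 : -((∑ ω, f ω) / (Fintype.card E : ℝ) ^ (m + 1)) + L ^ 2 * ((m + 1 : ℕ) : ℝ) =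
              (-((∑ ω, f ω) / (Fintype.card E : ℝ) ^ (m + 1)) + L ^ 2) + L ^ 2 * m := by
            push_cast
            ring
          rw [h4, h5, Real.exp_add _ (L ^ 2 * m), pow_succ]
          ring

/-- The average of a Lipschitz function over a subset of relative size at least `exp (-K)` of a
product space is not much less than its average over the whole space. -/
theorem average_ge_of_lipschitz {E : Type*} [Fintype E] [Nonempty E] (L s K : ℝ) (hs : 0 < s)
    (hL : s * L ≤ 1) (m : ℕ) (f : (Fin m → E) → ℝ)
    (hf : ∀ ω i e, |f (Function.update ω i e) - f ω| ≤ L) (A : Finset (Fin m → E))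
    (hA : A.Nonempty) (hK : (Fintype.card E : ℝ) ^ m ≤ Real.exp K * A.card) :
    (∑ ω, f ω) / (Fintype.card E : ℝ) ^ m - s * L ^ 2 * m - K / s ≤
      (∑ ω ∈ A, f ω) / A.card := by
  have hA0 : (0 : ℝ) < A.card := by exact_mod_cast hA.card_pos
  have h1 := sum_exp_neg_le_of_lipschitz (s * L) hL m (fun ω => s * f ω) (by
    intro ω i e
    rw [← mul_sub, abs_mul, abs_of_pos hs]
    gcongr
    exact hf ω i e)
  rw [← Finset.mul_sum, mul_div_assoc] at h1
  set M : ℝ := (∑ ω, f ω) / (Fintype.card E : ℝ) ^ m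
  set a : ℝ := (∑ ω ∈ A, f ω) / A.card with ha
  -- Jensen's inequality, in the form of the tangent line at the average over `A`
  have h2 : A.card * Real.exp (-(s * a)) ≤ ∑ ω ∈ A, Real.exp (-(s * f ω)) := by
    have hsum : ∑ ω ∈ A, (1 - s * (f ω - a)) = A.card := by
      rw [Finset.sum_sub_distrib, ← Finset.mul_sum, Finset.sum_sub_distrib, Finset.sum_const,
        Finset.sum_const, nsmul_eq_mul, nsmul_eq_mul, ha]
      field_simp
      ring
    calc A.card * Real.exp (-(s * a)) = ∑ ω ∈ A, (1 - s * (f ω - a)) * Real.exp (-(s * a)) := by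
          rw [← Finset.sum_mul, hsum]
      _ ≤ ∑ ω ∈ A, Real.exp (-(s * (f ω - a))) * Real.exp (-(s * a)) := by
          refine Finset.sum_le_sum fun ω _ => ?_
          gcongr
          have := Real.add_one_le_exp (-(s * (f ω - a)))
          linarith
      _ = _ := by
          refine Finset.sum_congr rfl fun ω _ => ?_
          rw [← Real.exp_add]
          ring_nf
  have h3 : ∑ ω ∈ A, Real.exp (-(s * f ω)) ≤ ∑ ω, Real.exp (-(s * f ω)) :=
    Finset.sum_le_sum_of_subset_of_nonneg (Finset.subset_univ _) fun _ _ _ => (Real.exp_pos _).le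
  have h4 : A.card * Real.exp (-(s * a)) ≤
      A.card * Real.exp (K + (-(s * M) + (s * L) ^ 2 * m)) := by
    refine (h2.trans (h3.trans h1)).trans ?_
    rw [Real.exp_add K]
    calc _ ≤ (Real.exp K * A.card) * Real.exp (-(s * M) + (s * L) ^ 2 * m) := by gcongr
      _ = _ := by ring
  have h5 := Real.exp_le_exp.1 (le_of_mul_le_mul_left h4 hA0)
  have h6 : s * (M - s * L ^ 2 * m - K / s) ≤ s * a := by
    have : s * (K / s) = K := by field_simp
    rw [mul_sub, mul_sub, this]
    nlinarith
  exact le_of_mul_le_mul_left h6 hs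

/-! ### Explorations -/

/-- The individuals of generation at most `ℓ` in the family tree with offspring numbers `k`. -/
def generations (k : List ℕ → ℕ) (ℓ : ℕ) : Set (List ℕ) := {w | IsIndividual k w ∧ w.length ≤ ℓ}

/-- `ψ` identifies the first `ℓ + 1` generations of the family tree with offspring numbers `k` with
vertices of `G`, in such a way that the vertices of the generations up to `ℓ` have no neighbours
besides their parent and their children. There may be edges inside the last generation. -/
structure IsExploration (k : List ℕ → ℕ) (ℓ : ℕ) {V : Type} (G : SimpleGraph V)
    (ψ : List ℕ → V) : Prop where
  inj : Set.InjOn ψ (generations k (ℓ + 1))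
  adj : ∀ w ∈ generations k ℓ, ∀ x,
    G.Adj (ψ w) x ↔ (∃ i < k w, x = ψ (i :: w)) ∨ (w ≠ [] ∧ x = ψ w.tail)

/-- Siblings are labelled in increasing order. -/
def SiblingMono (k : List ℕ → ℕ) (ℓ : ℕ) {n : ℕ} (ψ : List ℕ → Fin n) : Prop :=
  ∀ w ∈ generations k ℓ, ∀ i j, i < j → j < k w → ψ (i :: w) < ψ (j :: w)

/-- The neighbourhood of `v` in `G` up to distance `ℓ + 1` is given by the offspring numbers `k`,
where the children of a vertex are numbered in the order of their labels. -/
def HasType (k : List ℕ → ℕ) (ℓ : ℕ) {n : ℕ} (G : SimpleGraph (Fin n)) (v : Fin n) : Prop :=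
  ∃ ψ : List ℕ → Fin n, ψ [] = v ∧ IsExploration k ℓ G ψ ∧ SiblingMono k ℓ ψ

theorem nil_mem_generations (k : List ℕ → ℕ) (ℓ : ℕ) : [] ∈ generations k ℓ :=
  ⟨trivial, Nat.zero_le _⟩

theorem cons_mem_generations {k : List ℕ → ℕ} {ℓ i : ℕ} {w : List ℕ} :
    i :: w ∈ generations k (ℓ + 1) ↔ w ∈ generations k ℓ ∧ i < k w := by
  constructor
  · rintro ⟨⟨h1, h2⟩, h3⟩
    exact ⟨⟨h1, by simpa using h3⟩, h2⟩
  · rintro ⟨⟨h1, h2⟩, h3⟩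
    exact ⟨⟨h1, h3⟩, by simpa using h2⟩

theorem generations_mono {k : List ℕ → ℕ} {ℓ ℓ' : ℕ} (h : ℓ ≤ ℓ') :
    generations k ℓ ⊆ generations k ℓ' := fun _ hw => ⟨hw.1, hw.2.trans h⟩

theorem tail_mem_generations {k : List ℕ → ℕ} {ℓ : ℕ} {w : List ℕ} (h : w ∈ generations k ℓ) :
    w.tail ∈ generations k ℓ := by
  cases w with
  | nil => exact h
  | cons i w => exact ⟨h.1.1, by have := h.2; simp at this; simp; omega⟩

theorem finite_generations (k : List ℕ → ℕ) (ℓ : ℕ) : (generations k ℓ).Finite := by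
  induction ℓ with
  | zero =>
    refine (Set.finite_singleton []).subset fun w hw => ?_
    simpa using hw.2
  | succ ℓ ih =>
    have h := (ih.biUnion fun w _ => ((Set.finite_Iio (k w)).image fun i => i :: w)).insert []
    refine h.subset fun w hw => ?_
    cases w with
    | nil => exact Set.mem_insert _ _
    | cons i w =>
      have := cons_mem_generations.1 hw
      refine Set.mem_insert_of_mem _ (Set.mem_biUnion this.1 ⟨i, this.2, rfl⟩)

theorem isIndividual_congr {k k' : List ℕ → ℕ} {ℓ : ℕ} (h : ∀ w ∈ generations k ℓ, k' w = k w)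
    (w : List ℕ) (hw : w.length ≤ ℓ + 1) : IsIndividual k' w ↔ IsIndividual k w := by
  induction w with
  | nil => exact Iff.rfl
  | cons i w ih =>
    have hl : w.length ≤ ℓ := by simpa using hw
    have ih' := ih (by omega)
    show (IsIndividual k' w ∧ i < k' w) ↔ (IsIndividual k w ∧ i < k w)
    rw [ih']
    refine and_congr_right fun hi => ?_
    rw [h w ⟨hi, hl⟩]

/-! ### The ball in terms of an exploration -/

namespace IsExploration

variable {k : List ℕ → ℕ} {ℓ : ℕ} {V : Type} {G : SimpleGraph V} {ψ : List ℕ → V}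

theorem edist_le_iff (h : IsExploration k ℓ G ψ) (x : V) :
    G.edist (ψ []) x ≤ (ℓ : ℕ∞) ↔ ∃ w ∈ generations k ℓ, ψ w = x := by
  constructor
  · intro hx
    have hne : G.edist (ψ []) x ≠ ⊤ := ne_top_of_le_ne_top (ENat.natCast_ne_top ℓ) hx
    obtain ⟨p, hp⟩ := SimpleGraph.exists_walk_of_edist_ne_top hne
    rw [← hp] at hx
    have hl : p.length ≤ ℓ := by exact_mod_cast hx
    have key : ∀ (a b : V) (q : G.Walk a b) (u : List ℕ), IsIndividual k u → ψ u = a →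
        u.length + q.length ≤ ℓ → ∃ w ∈ generations k ℓ, ψ w = b := by
      intro a b q
      induction q with
      | nil =>
        intro u hu hua hul
        exact ⟨u, ⟨hu, by simpa using hul⟩, hua⟩
      | cons hadj q ih =>
        intro u hu hua hul
        rw [SimpleGraph.Walk.length_cons] at hul
        subst hua
        have hug : u ∈ generations k ℓ := ⟨hu, by omega⟩
        rcases (h.adj u hug _).1 hadj with ⟨i, hi, rfl⟩ | ⟨-, rfl⟩
        · exact ih (i :: u) ⟨hu, hi⟩ rfl (by simp; omega)
        · exact ih u.tail (tail_mem_generations hug).1 rfl (by simp; omega)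
    exact key _ _ p [] trivial rfl (by simpa using hl)
  · rintro ⟨w, hw, rfl⟩
    have key : ∀ w, w ∈ generations k ℓ → G.edist (ψ []) (ψ w) ≤ (w.length : ℕ∞) := by
      intro w
      induction w with
      | nil => simp
      | cons i w ih =>
        intro hw
        have hw' : w ∈ generations k ℓ := tail_mem_generations hw
        have hadj : G.Adj (ψ w) (ψ (i :: w)) := (h.adj w hw' _).2 (.inl ⟨i, hw.1.2, rfl⟩)
        calc G.edist (ψ []) (ψ (i :: w)) ≤ G.edist (ψ []) (ψ w) + G.edist (ψ w) (ψ (i :: w)) :=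
              G.edist_triangle
          _ ≤ (w.length : ℕ∞) + 1 := by
              gcongr
              · exact ih hw'
              · exact (SimpleGraph.edist_eq_one_iff_adj.2 hadj).le
          _ = ((i :: w).length : ℕ∞) := by simp
    exact (key w hw).trans (by exact_mod_cast hw.2)

theorem adj_iff (h : IsExploration k ℓ G ψ) {u w : List ℕ} (hu : u ∈ generations k ℓ)
    (hw : w ∈ generations k ℓ) :
    G.Adj (ψ u) (ψ w) ↔ (∃ i < k u, w = i :: u) ∨ (u ≠ [] ∧ w = u.tail) := by
  have hle := Nat.le_succ ℓ
  have hw' := generations_mono hle hw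
  rw [h.adj u hu]
  constructor
  · rintro (⟨i, hi, he⟩ | ⟨hu0, he⟩)
    · exact .inl ⟨i, hi, h.inj hw' (cons_mem_generations.2 ⟨hu, hi⟩) he⟩
    · exact .inr ⟨hu0, h.inj hw' (generations_mono hle (tail_mem_generations hu)) he⟩
  · rintro (⟨i, hi, rfl⟩ | ⟨hu0, rfl⟩)
    · exact .inl ⟨i, hi, rfl⟩
    · exact .inr ⟨hu0, rfl⟩

/-- An exploration identifies the ball with the first generations. -/
noncomputable def ballEquiv (h : IsExploration k ℓ G ψ) :
    generations k ℓ ≃ {v : V // G.edist (ψ []) v ≤ (ℓ : ℕ∞)} :=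
  Equiv.ofBijective (fun w => ⟨ψ w, (h.edist_le_iff _).2 ⟨w, w.2, rfl⟩⟩) <| by
    constructor
    · intro u w huw
      exact Subtype.ext (h.inj (generations_mono (Nat.le_succ ℓ) u.2)
        (generations_mono (Nat.le_succ ℓ) w.2) (congrArg Subtype.val huw))
    · rintro ⟨v, hv⟩
      obtain ⟨w, hw, rfl⟩ := (h.edist_le_iff v).1 hv
      exact ⟨⟨w, hw⟩, rfl⟩

theorem ball_isomorphic {V' : Type} {G' : SimpleGraph V'} {ψ' : List ℕ → V'}
    (h : IsExploration k ℓ G ψ) (h' : IsExploration k ℓ G' ψ') :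
    (RootedGraph.ball ℓ ⟨V, G, ψ []⟩).Isomorphic (RootedGraph.ball ℓ ⟨V', G', ψ' []⟩) := by
  let φ : G.comap (Subtype.val : {v : V // G.edist (ψ []) v ≤ (ℓ : ℕ∞)} → V) ≃g
      G'.comap (Subtype.val : {v : V' // G'.edist (ψ' []) v ≤ (ℓ : ℕ∞)} → V') :=
    ⟨h.ballEquiv.symm.trans h'.ballEquiv, by
      intro a b
      obtain ⟨u, rfl⟩ := h.ballEquiv.surjective a
      obtain ⟨w, rfl⟩ := h.ballEquiv.surjective b
      simp only [Equiv.trans_apply, Equiv.symm_apply_apply]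
      exact (h'.adj_iff u.2 w.2).trans (h.adj_iff u.2 w.2).symm⟩
  refine ⟨φ, ?_⟩
  show h'.ballEquiv (h.ballEquiv.symm (h.ballEquiv ⟨[], nil_mem_generations k ℓ⟩)) =
    h'.ballEquiv ⟨[], nil_mem_generations k ℓ⟩
  rw [Equiv.symm_apply_apply]

end IsExploration

theorem RootedGraph.Isomorphic.symm {G H : RootedGraph} (h : G.Isomorphic H) : H.Isomorphic G := by
  obtain ⟨φ, hφ⟩ := h
  exact ⟨φ.symm, by rw [← hφ]; exact φ.symm_apply_apply _⟩

theorem RootedGraph.Isomorphic.trans {G H K : RootedGraph} (h : G.Isomorphic H)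
    (h' : H.Isomorphic K) : G.Isomorphic K := by
  obtain ⟨φ, hφ⟩ := h
  obtain ⟨φ', hφ'⟩ := h'
  exact ⟨φ.trans φ', by rw [← hφ', ← hφ]; rfl⟩

theorem familyTree_adj {X : List ℕ → ℕ} (u v : {w : List ℕ // IsIndividual X w}) :
    (familyTree X).graph.Adj u v ↔
      u ≠ v ∧ ((∃ i, v.val = i :: u.val) ∨ ∃ i, u.val = i :: v.val) :=
  SimpleGraph.fromRel_adj _ _ _

open Classical in
/-- The family tree is explored by the words themselves. -/
theorem exists_isExploration_familyTree {X k : List ℕ → ℕ} {ℓ : ℕ}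
    (h : ∀ w ∈ generations k ℓ, X w = k w) :
    ∃ ψ : List ℕ → (familyTree X).V, ψ [] = (familyTree X).root ∧
      IsExploration k ℓ (familyTree X).graph ψ := by
  have hind := isIndividual_congr h
  have hX : ∀ w ∈ generations k (ℓ + 1), IsIndividual X w := fun w hw => (hind w hw.2).2 hw.1
  let ψ : List ℕ → {w : List ℕ // IsIndividual X w} := fun w =>
    if hw : IsIndividual X w then ⟨w, hw⟩ else ⟨[], trivial⟩
  have hψ : ∀ w ∈ generations k (ℓ + 1), (ψ w).val = w := by
    intro w hw
    simp only [ψ, dif_pos (hX w hw)]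
  have hle := generations_mono (k := k) (Nat.le_succ ℓ)
  refine ⟨ψ, ?_, ?_, ?_⟩
  · exact Subtype.ext (hψ _ (nil_mem_generations k _))
  · intro u hu w hw huw
    rw [← hψ u hu, ← hψ w hw, huw]
  · intro w hw (x : {w : List ℕ // IsIndividual X w})
    refine (familyTree_adj (ψ w) x).trans ?_
    rw [hψ w (hle hw)]
    constructor
    · rintro ⟨-, ⟨i, hi⟩ | ⟨i, hi⟩⟩
      · have hx : IsIndividual X (i :: w) := hi ▸ x.2
        have hik : i < k w := by
          rw [← h w hw]
          exact hx.2
        refine .inl ⟨i, hik, Subtype.ext ?_⟩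
        rw [hψ _ (cons_mem_generations.2 ⟨hw, hik⟩), hi]
      · refine .inr ⟨by rw [hi]; simp, Subtype.ext ?_⟩
        rw [hψ _ (hle (tail_mem_generations hw)), hi, List.tail_cons]
    · rintro (⟨i, hi, rfl⟩ | ⟨hw0, rfl⟩)
      · have hv := hψ _ (cons_mem_generations.2 ⟨hw, hi⟩)
        refine ⟨fun he => ?_, .inl ⟨i, hv⟩⟩
        have := congrArg (fun v : {w : List ℕ // IsIndividual X w} => v.val.length) he
        simp only [hv, hψ w (hle hw), List.length_cons] at this
        omega
      · obtain ⟨i, u, rfl⟩ := List.exists_cons_of_ne_nil hw0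
        have hv : (ψ u).val = u := hψ _ (hle (tail_mem_generations hw))
        refine ⟨fun he => ?_, .inr ⟨i, by rw [List.tail_cons, hv]⟩⟩
        have := congrArg (fun v : {w : List ℕ // IsIndividual X w} => v.val.length) he
        simp only [hv, hψ _ (hle hw), List.length_cons, List.tail_cons] at this
        omega

/-- A vertex of type `k` and a family tree which agrees with `k` have isomorphic balls. -/
theorem HasType.ball_isomorphic {k X : List ℕ → ℕ} {ℓ n : ℕ} {G : SimpleGraph (Fin n)} {v : Fin n}
    (hv : HasType k ℓ G v) (hX : ∀ w ∈ generations k ℓ, X w = k w) :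
    ((rootedOfPair n (G, v)).ball ℓ).Isomorphic ((familyTree X).ball ℓ) := by
  obtain ⟨ψ, rfl, hψ, -⟩ := hv
  obtain ⟨ψ', h0, hψ'⟩ := exists_isExploration_familyTree hX
  have h := hψ.ball_isomorphic hψ'
  rw [h0] at h
  exact h

/-! ### The type of a vertex is unique -/

theorem strictMono_unique {n a b : ℕ} {f g : ℕ → Fin n}
    (hf : ∀ i j, i < j → j < a → f i < f j) (hg : ∀ i j, i < j → j < b → g i < g j)
    (h : ∀ x, (∃ i < a, x = f i) ↔ ∃ i < b, x = g i) : a = b ∧ ∀ i < a, f i = g i := by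
  have hf' : StrictMono fun i : Fin a => f i := fun i j hij => hf i j hij j.2
  have hg' : StrictMono fun i : Fin b => g i := fun i j hij => hg i j hij j.2
  have hr : Set.range (fun i : Fin a => f i) = Set.range fun i : Fin b => g i := by
    ext x
    simp only [Set.mem_range, Fin.exists_iff]
    constructor
    · rintro ⟨i, hi, rfl⟩
      obtain ⟨j, hj, hjx⟩ := (h (f i)).1 ⟨i, hi, rfl⟩
      exact ⟨j, hj, hjx.symm⟩
    · rintro ⟨i, hi, rfl⟩
      obtain ⟨j, hj, hjx⟩ := (h (g i)).2 ⟨i, hi, rfl⟩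
      exact ⟨j, hj, hjx.symm⟩
  have hab : a = b := by
    have h1 := Set.ncard_range_of_injective hf'.injective
    have h2 := Set.ncard_range_of_injective hg'.injective
    rw [hr, h2] at h1
    simpa using h1.symm
  subst hab
  refine ⟨rfl, fun i hi => ?_⟩
  exact congrFun ((hf'.range_inj hg').1 hr) ⟨i, hi⟩

theorem IsExploration.exists_child_iff {k : List ℕ → ℕ} {ℓ : ℕ} {V : Type} {G : SimpleGraph V}
    {ψ : List ℕ → V} (h : IsExploration k ℓ G ψ) {w : List ℕ} (hw : w ∈ generations k ℓ) (x : V) :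
    (∃ i < k w, x = ψ (i :: w)) ↔ G.Adj (ψ w) x ∧ ¬ (w ≠ [] ∧ x = ψ w.tail) := by
  rw [h.adj w hw]
  constructor
  · rintro ⟨i, hi, rfl⟩
    refine ⟨.inl ⟨i, hi, rfl⟩, fun ⟨_, he⟩ => ?_⟩
    have := h.inj (cons_mem_generations.2 ⟨hw, hi⟩)
      (generations_mono (Nat.le_succ ℓ) (tail_mem_generations hw)) he
    have := congrArg List.length this
    simp at this
    omega
  · rintro ⟨h1 | h1, h2⟩
    · exact h1
    · exact absurd h1 h2

theorem exploration_unique {k k' : List ℕ → ℕ} {ℓ n : ℕ} {G : SimpleGraph (Fin n)}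
    {ψ ψ' : List ℕ → Fin n} (h : IsExploration k ℓ G ψ) (hm : SiblingMono k ℓ ψ)
    (h' : IsExploration k' ℓ G ψ') (hm' : SiblingMono k' ℓ ψ') (h0 : ψ [] = ψ' []) :
    (∀ w ∈ generations k (ℓ + 1), w ∈ generations k' (ℓ + 1) ∧ ψ w = ψ' w) ∧
      ∀ w ∈ generations k ℓ, k w = k' w := by
  have hstep : ∀ w ∈ generations k ℓ, w ∈ generations k' ℓ → ψ w = ψ' w → ψ w.tail = ψ' w.tail →
      k w = k' w ∧ ∀ i < k w, ψ (i :: w) = ψ' (i :: w) := by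
    intro w hw hw' h1 h2
    refine strictMono_unique (hm w hw) (hm' w hw') fun x => ?_
    rw [h.exists_child_iff hw, h'.exists_child_iff hw', h1, h2]
  have key : ∀ w, (w ∈ generations k (ℓ + 1) → w ∈ generations k' (ℓ + 1) ∧ ψ w = ψ' w) ∧
      (w.tail ∈ generations k (ℓ + 1) → ψ w.tail = ψ' w.tail) := by
    intro w
    induction w with
    | nil => exact ⟨fun _ => ⟨nil_mem_generations _ _, h0⟩, fun _ => h0⟩
    | cons i w ih =>
      refine ⟨fun hw => ?_, fun hw => (ih.1 hw).2⟩
      obtain ⟨hw1, hi⟩ := cons_mem_generations.1 hw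
      have hw2 := generations_mono (Nat.le_succ ℓ) hw1
      have hw1' : w ∈ generations k' ℓ := ⟨(ih.1 hw2).1.1, hw1.2⟩
      obtain ⟨hk, hc⟩ := hstep w hw1 hw1' (ih.1 hw2).2 (ih.2 (tail_mem_generations hw2))
      exact ⟨cons_mem_generations.2 ⟨hw1', hk ▸ hi⟩, hc i hi⟩
  refine ⟨fun w hw => (key w).1 hw, fun w hw => ?_⟩
  have hw2 := generations_mono (Nat.le_succ ℓ) hw
  exact (hstep w hw ⟨((key w).1 hw2).1.1, hw.2⟩ ((key w).1 hw2).2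
    ((key w).2 (tail_mem_generations hw2))).1

/-- The offspring numbers vanish except at individuals of generation at most `ℓ`. -/
def IsShape (ℓ : ℕ) (k : List ℕ → ℕ) : Prop := ∀ w, k w ≠ 0 → w ∈ generations k ℓ

theorem HasType.unique {k k' : List ℕ → ℕ} {ℓ n : ℕ} {G : SimpleGraph (Fin n)} {v : Fin n}
    (hk : IsShape ℓ k) (hk' : IsShape ℓ k') (h : HasType k ℓ G v) (h' : HasType k' ℓ G v) :
    k = k' := by
  obtain ⟨ψ, hv, hψ, hm⟩ := h
  obtain ⟨ψ', hv', hψ', hm'⟩ := h'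
  have h1 := (exploration_unique hψ hm hψ' hm' (hv.trans hv'.symm)).2
  have h2 := (exploration_unique hψ' hm' hψ hm (hv'.trans hv.symm)).2
  funext w
  by_cases hw : k w = 0
  · by_contra hne
    have := h2 w (hk' w fun h => hne (hw.trans h.symm))
    exact hne this.symm
  · exact h1 w (hk w hw)

/-! ### Changing an edge changes few types -/

/-- Few roots `v` have an exploration which puts `x` at the place `w`: the path from `x` back to `v`
starts, at each step, from a vertex of degree at most `D`. -/
theorem card_filter_exploration_le {k : List ℕ → ℕ} {ℓ D n : ℕ} (hD : ∀ w, k w + 1 ≤ D)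
    (G : SimpleGraph (Fin n)) (w : List ℕ) (hw : w ∈ generations k ℓ) (x : Fin n)
    [DecidablePred fun v => ∃ ψ, ψ [] = v ∧ IsExploration k ℓ G ψ ∧ ψ w = x] :
    (Finset.univ.filter fun v => ∃ ψ, ψ [] = v ∧ IsExploration k ℓ G ψ ∧ ψ w = x).card
      ≤ D ^ w.length := by
  classical
  induction w generalizing x with
  | nil =>
    refine le_trans (Finset.card_le_card (t := {x}) ?_) (by simp)
    intro v hv
    simp only [Finset.mem_filter, Finset.mem_univ, true_and] at hv
    obtain ⟨ψ, h1, -, h2⟩ := hv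
    rw [Finset.mem_singleton, ← h1, h2]
  | cons i w ih =>
    by_cases hex : ∃ v ψ, ψ [] = v ∧ IsExploration k ℓ G ψ ∧ ψ (i :: w) = x
    · have hw' : w ∈ generations k ℓ := tail_mem_generations hw
      have hN : (Finset.univ.filter fun z => G.Adj x z).card ≤ D := by
        obtain ⟨v, ψ, -, hψ, rfl⟩ := hex
        have hsub : (Finset.univ.filter fun z => G.Adj (ψ (i :: w)) z) ⊆
            insert (ψ w) ((Finset.range (k (i :: w))).image fun j => ψ (j :: i :: w)) := by
          intro z hz
          simp only [Finset.mem_filter, Finset.mem_univ, true_and] at hz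
          rcases (hψ.adj _ hw z).1 hz with ⟨j, hj, rfl⟩ | ⟨-, rfl⟩
          · exact Finset.mem_insert_of_mem
              (Finset.mem_image.2 ⟨j, Finset.mem_range.2 hj, rfl⟩)
          · exact Finset.mem_insert_self _ _
        refine (Finset.card_le_card hsub).trans ((Finset.card_insert_le _ _).trans ?_)
        have := (Finset.card_image_le (s := Finset.range (k (i :: w)))
          (f := fun j => ψ (j :: i :: w)))
        rw [Finset.card_range] at this
        have := hD (i :: w)
        omega
      have hsub : (Finset.univ.filter fun v =>
          ∃ ψ, ψ [] = v ∧ IsExploration k ℓ G ψ ∧ ψ (i :: w) = x) ⊆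
          (Finset.univ.filter fun z => G.Adj x z).biUnion fun z =>
            Finset.univ.filter fun v => ∃ ψ, ψ [] = v ∧ IsExploration k ℓ G ψ ∧ ψ w = z := by
        intro v hv
        simp only [Finset.mem_filter, Finset.mem_univ, true_and] at hv
        obtain ⟨ψ, h1, hψ, rfl⟩ := hv
        simp only [Finset.mem_biUnion, Finset.mem_filter, Finset.mem_univ, true_and]
        exact ⟨ψ w, (hψ.adj _ hw _).2 (.inr ⟨by simp, rfl⟩), ψ, h1, hψ, rfl⟩
      refine (Finset.card_le_card hsub).trans
        ((Finset.card_biUnion_le_card_mul _ _ (D ^ w.length) fun z _ => ih hw' z).trans ?_)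
      rw [List.length_cons, pow_succ, mul_comm]
      gcongr
    · rw [Finset.filter_false_of_mem fun v _ hv => hex ⟨v, hv⟩]
      simp

open Classical in
/-- The number of vertices of a given type changes by a bounded amount if the graph changes at
four vertices only. -/
theorem exists_card_hasType_le (k : List ℕ →₀ ℕ) (ℓ : ℕ) :
    ∃ L : ℕ, ∀ (n : ℕ) (G G' : SimpleGraph (Fin n)) (B : Finset (Fin n)), B.card ≤ 4 →
      (∀ a ∉ B, ∀ z, G.Adj a z ↔ G'.Adj a z) →
      (Finset.univ.filter fun v => HasType k ℓ G v).card ≤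
        (Finset.univ.filter fun v => HasType k ℓ G' v).card + L := by
  obtain ⟨D, hD⟩ : ∃ D, ∀ w, k w + 1 ≤ D := by
    refine ⟨k.support.sup k + 1, fun w => Nat.add_le_add_right ?_ 1⟩
    by_cases hw : w ∈ k.support
    · exact Finset.le_sup (f := k) hw
    · rw [Finsupp.notMem_support_iff.1 hw]
      exact Nat.zero_le _
  have hI := finite_generations k ℓ
  refine ⟨4 * (hI.toFinset.card * D ^ ℓ), fun n G G' B hB hGG' => ?_⟩
  have hsub : (Finset.univ.filter fun v => HasType k ℓ G v) ⊆
      (Finset.univ.filter fun v => HasType k ℓ G' v) ∪ B.biUnion fun x => hI.toFinset.biUnion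
        fun w => Finset.univ.filter fun v => ∃ ψ, ψ [] = v ∧ IsExploration k ℓ G ψ ∧ ψ w = x := by
    intro v hv
    simp only [Finset.mem_filter, Finset.mem_univ, true_and] at hv
    obtain ⟨ψ, hψv, hψ, hm⟩ := hv
    by_cases hex : ∃ w ∈ generations k ℓ, ψ w ∈ B
    · obtain ⟨w, hw, hwB⟩ := hex
      refine Finset.mem_union_right _ (Finset.mem_biUnion.2 ⟨ψ w, hwB, Finset.mem_biUnion.2
        ⟨w, hI.mem_toFinset.2 hw, ?_⟩⟩)
      simp only [Finset.mem_filter, Finset.mem_univ, true_and]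
      exact ⟨ψ, hψv, hψ, rfl⟩
    · push Not at hex
      refine Finset.mem_union_left _ ?_
      simp only [Finset.mem_filter, Finset.mem_univ, true_and]
      refine ⟨ψ, hψv, ⟨hψ.inj, fun w hw x => ?_⟩, hm⟩
      rw [← hGG' _ (hex w hw), hψ.adj w hw]
  refine (Finset.card_le_card hsub).trans ((Finset.card_union_le _ _).trans ?_)
  refine Nat.add_le_add_left ?_ _
  refine (Finset.card_biUnion_le_card_mul _ _ (hI.toFinset.card * D ^ ℓ) fun x _ => ?_).trans
    (Nat.mul_le_mul_right _ hB)
  refine Finset.card_biUnion_le_card_mul _ _ _ fun w hw => ?_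
  rw [Set.Finite.mem_toFinset] at hw
  refine (card_filter_exploration_le hD G w hw x).trans ?_
  exact Nat.pow_le_pow_right (by have := hD []; omega) hw.2

/-! ### Expected number of vertices of a given type -/

/-- The simple graph whose edges are the (non-loop) entries of a sequence. -/
def graphOf {n m : ℕ} (ω : Fin m → Sym2 (Fin n)) : SimpleGraph (Fin n) :=
  SimpleGraph.fromEdgeSet (Set.range ω)

/-- The individuals of generations `1` to `ℓ + 1`, as pairs of a parent and a number. -/
abbrev Child (k : List ℕ → ℕ) (ℓ : ℕ) : Type := (w : generations k ℓ) × Fin (k w)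

noncomputable instance (k : List ℕ → ℕ) (ℓ : ℕ) : Fintype (generations k ℓ) :=
  (finite_generations k ℓ).fintype

open Classical in
/-- Let `ψ` be a labelling of the first `ℓ + 1` generations by distinct vertices. It is an
exploration of the graph of `ω` if each edge of the tree appears once in `ω`, and no other
entry of `ω` meets the generations up to `ℓ`. -/
theorem le_card_filter_isExploration {k : List ℕ → ℕ} {ℓ n : ℕ} (m : ℕ) {ψ : List ℕ → Fin n}
    (hψ : Set.InjOn ψ (generations k (ℓ + 1))) :
    m.descFactorial (Fintype.card (Child k ℓ)) *
        ((n + 1).choose 2 - Fintype.card (generations k ℓ) * n) ^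
          (m - Fintype.card (Child k ℓ)) ≤
      (Finset.univ.filter fun ω : Fin m → Sym2 (Fin n) =>
        IsExploration k ℓ (graphOf ω) ψ).card := by
  let e : Child k ℓ → Sym2 (Fin n) := fun u => s(ψ u.1, ψ (u.2.1 :: u.1.1))
  have hle := generations_mono (k := k) (Nat.le_succ ℓ)
  have hch : ∀ u : Child k ℓ, u.2.1 :: u.1.1 ∈ generations k (ℓ + 1) :=
    fun u => cons_mem_generations.2 ⟨u.1.2, u.2.2⟩
  have he : Function.Injective e := by
    rintro ⟨⟨w, hw⟩, ⟨i, hi⟩⟩ ⟨⟨w', hw'⟩, ⟨i', hi'⟩⟩ h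
    have hc := cons_mem_generations.2 ⟨hw, hi⟩
    have hc' := cons_mem_generations.2 ⟨hw', hi'⟩
    simp only [e, Sym2.eq_iff] at h
    rcases h with ⟨-, h⟩ | ⟨h1, h2⟩
    · have := hψ hc hc' h
      simp only [List.cons.injEq] at this
      obtain ⟨rfl, rfl⟩ := this
      rfl
    · have h1' := congrArg List.length (hψ (hle hw) hc' h1)
      have h2' := congrArg List.length (hψ hc (hle hw') h2)
      simp only [List.length_cons] at h1' h2'
      omega
  let B : Finset (Sym2 (Fin n)) := Finset.univ.biUnion fun w : generations k ℓ =>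
    Finset.univ.image fun x => s(ψ w, x)
  have hB : B.card ≤ Fintype.card (generations k ℓ) * n := by
    refine (Finset.card_biUnion_le_card_mul _ _ n fun w _ => ?_)
    exact Finset.card_image_le.trans (by simp)
  have heB : ∀ u, e u ∈ B := fun u => Finset.mem_biUnion.2
    ⟨u.1, Finset.mem_univ _, Finset.mem_image.2 ⟨_, Finset.mem_univ _, rfl⟩⟩
  have hBc : (n + 1).choose 2 - Fintype.card (generations k ℓ) * n ≤ Bᶜ.card := by
    rw [Finset.card_compl, Sym2.card, Fintype.card_fin]
    omega
  let P : (Child k ℓ ↪ Fin m) → Finset (Fin m → Sym2 (Fin n)) := fun ι =>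
    Fintype.piFinset fun j => if h : ∃ u, ι u = j then {e h.choose} else Bᶜ
  have hP1 : ∀ ι, ∀ ω ∈ P ι, ∀ u, ω (ι u) = e u := by
    intro ι ω hω u
    have h1 := Fintype.mem_piFinset.1 hω (ι u)
    have hex : ∃ u', ι u' = ι u := ⟨u, rfl⟩
    rw [dif_pos hex, Finset.mem_singleton] at h1
    rw [h1, ι.injective hex.choose_spec]
  have hP2 : ∀ ι, ∀ ω ∈ P ι, ∀ j, (∀ u, ι u ≠ j) → ω j ∉ B := by
    intro ι ω hω j hj
    have h1 := Fintype.mem_piFinset.1 hω j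
    rw [dif_neg fun ⟨u, hu⟩ => hj u hu] at h1
    exact Finset.mem_compl.1 h1
  have hcard : ∀ ι, ((n + 1).choose 2 - Fintype.card (generations k ℓ) * n) ^
      (m - Fintype.card (Child k ℓ)) ≤ (P ι).card := by
    intro ι
    have h1 : (P ι).card = ∏ j : Fin m, if ∃ u, ι u = j then 1 else Bᶜ.card := by
      rw [Fintype.card_piFinset]
      refine Finset.prod_congr rfl fun j _ => ?_
      split_ifs <;> simp
    rw [h1, Finset.prod_ite, Finset.prod_const_one, one_mul, Finset.prod_const]
    have h2 : (Finset.univ.filter fun j : Fin m => ¬ ∃ u, ι u = j).card =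
        m - Fintype.card (Child k ℓ) := by
      have h3 : (Finset.univ.filter fun j : Fin m => ¬ ∃ u, ι u = j) =
          (Finset.univ.map ι)ᶜ := by
        ext j
        simp
      rw [h3, Finset.card_compl, Finset.card_map, Finset.card_univ, Fintype.card_fin]
    rw [h2]
    exact Nat.pow_le_pow_left hBc _
  have hdisj : (↑(Finset.univ : Finset (Child k ℓ ↪ Fin m)) : Set _).PairwiseDisjoint P := by
    intro ι _ ι' _ hne
    rw [Function.onFun, Finset.disjoint_left]
    intro ω hω hω'
    refine hne (DFunLike.ext _ _ fun u => ?_)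
    by_contra hu
    by_cases hex : ∃ u', ι' u' = ι u
    · obtain ⟨u', hu'⟩ := hex
      have : e u' = e u := by rw [← hP1 ι' ω hω' u', hu', hP1 ι ω hω u]
      rw [he this] at hu'
      exact hu hu'.symm
    · push Not at hex
      exact hP2 ι' ω hω' _ hex (by rw [hP1 ι ω hω]; exact heB u)
  have hsub : Finset.univ.biUnion P ⊆
      Finset.univ.filter fun ω : Fin m → Sym2 (Fin n) => IsExploration k ℓ (graphOf ω) ψ := by
    intro ω hω
    obtain ⟨ι, -, hω⟩ := Finset.mem_biUnion.1 hω
    refine Finset.mem_filter.2 ⟨Finset.mem_univ _, hψ, fun w hw x => ?_⟩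
    rw [graphOf, SimpleGraph.fromEdgeSet_adj]
    constructor
    · rintro ⟨⟨j, hj⟩, -⟩
      by_cases hex : ∃ u, ι u = j
      · obtain ⟨⟨⟨w', hw'⟩, ⟨i, hi⟩⟩, rfl⟩ := hex
        rw [hP1 ι ω hω] at hj
        simp only [e, Sym2.eq_iff] at hj
        rcases hj with ⟨h1, h2⟩ | ⟨h1, h2⟩
        · have := hψ (hle hw') (hle hw) h1
          subst this
          exact .inl ⟨i, hi, h2.symm⟩
        · have := hψ (cons_mem_generations.2 ⟨hw', hi⟩) (hle hw) h2
          subst this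
          exact .inr ⟨by simp, h1.symm⟩
      · push Not at hex
        refine absurd ?_ (hP2 ι ω hω j hex)
        rw [hj]
        exact Finset.mem_biUnion.2 ⟨⟨w, hw⟩, Finset.mem_univ _,
          Finset.mem_image.2 ⟨_, Finset.mem_univ _, rfl⟩⟩
    · rintro (⟨i, hi, rfl⟩ | ⟨hw0, rfl⟩)
      · refine ⟨⟨ι ⟨⟨w, hw⟩, ⟨i, hi⟩⟩, hP1 ι ω hω _⟩, fun h => ?_⟩
        have := congrArg List.length (hψ (hle hw) (cons_mem_generations.2 ⟨hw, hi⟩) h)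
        simp at this
      · obtain ⟨i, u, rfl⟩ := List.exists_cons_of_ne_nil hw0
        have hu : u ∈ generations k ℓ := tail_mem_generations hw
        refine ⟨⟨ι ⟨⟨u, hu⟩, ⟨i, hw.1.2⟩⟩, (hP1 ι ω hω _).trans Sym2.eq_swap⟩, fun h => ?_⟩
        have := congrArg List.length (hψ (hle hw) (hle hu) h)
        simp at this
  refine le_trans ?_ (Finset.card_le_card hsub)
  rw [Finset.card_biUnion hdisj]
  refine le_trans ?_ (Finset.card_nsmul_le_sum _ _ _ fun ι _ => hcard ι)
  rw [Finset.card_univ, Fintype.card_embedding_eq, Fintype.card_fin, smul_eq_mul]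

open Classical in
/-- A function on a disjoint union of blocks becomes increasing on each block after a permutation
of each block. -/
theorem descFactorial_le_prod_factorial_mul {I : Type*} [Fintype I] (k : I → ℕ) (n : ℕ) :
    n.descFactorial (Fintype.card ((w : I) × Fin (k w)) + 1) ≤ (∏ w, (k w).factorial) *
      (Finset.univ.filter fun φ : Option ((w : I) × Fin (k w)) → Fin n =>
        Function.Injective φ ∧ ∀ w i j, i < j → φ (some ⟨w, i⟩) < φ (some ⟨w, j⟩)).card := by
  have h1 : n.descFactorial (Fintype.card ((w : I) × Fin (k w)) + 1) =
      Fintype.card (Option ((w : I) × Fin (k w)) ↪ Fin n) := by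
    rw [Fintype.card_embedding_eq, Fintype.card_option, Fintype.card_fin]
  have h2 : ∏ w, (k w).factorial = Fintype.card (∀ w, Equiv.Perm (Fin (k w))) := by
    simp [Fintype.card_perm]
  rw [h1, h2, ← Finset.card_univ, ← Finset.card_univ, ← Finset.card_product]
  let σ : (Option ((w : I) × Fin (k w)) ↪ Fin n) → ∀ w, Equiv.Perm (Fin (k w)) := fun φ w =>
    Tuple.sort fun i => φ (some ⟨w, i⟩)
  refine Finset.card_le_card_of_injOn (fun φ => (σ φ, fun u => φ (u.map fun u =>
    ⟨u.1, σ φ u.1 u.2⟩))) ?_ ?_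
  · intro φ _
    simp only [Finset.coe_product, Set.mem_prod, Finset.coe_univ, Set.mem_univ, true_and,
      Finset.coe_filter, Set.mem_ofPred_eq, Finset.mem_univ]
    refine ⟨φ.injective.comp (Option.map_injective ?_), fun w i j hij => ?_⟩
    · rintro ⟨w, i⟩ ⟨w', i'⟩ h
      simp only [Sigma.mk.injEq] at h
      obtain ⟨rfl, h⟩ := h
      rw [(σ φ w).injective (eq_of_heq h)]
    · refine lt_of_le_of_ne (Tuple.monotone_sort (fun i => φ (some ⟨w, i⟩)) hij.le) fun h => ?_
      have := φ.injective h
      simp only [Option.map_some, Option.some.injEq, Sigma.mk.injEq, heq_eq_eq, true_and] at this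
      exact hij.ne ((σ φ w).injective this)
  · intro φ _ φ' _ h
    simp only [Prod.mk.injEq] at h
    obtain ⟨h1, h2⟩ := h
    refine DFunLike.ext _ _ fun u => ?_
    have h3 := congrFun h2 (u.map fun u => ⟨u.1, (σ φ u.1).symm u.2⟩)
    rw [← h1] at h3
    cases u with
    | none => simpa using h3
    | some u => simpa using h3

open Classical in
/-- The labelling of words given by a labelling of the root and of all children. -/
noncomputable def labelling {k : List ℕ → ℕ} {ℓ n : ℕ} (φ : Option (Child k ℓ) → Fin n) :
    List ℕ → Fin n
  | [] => φ none
  | i :: w => if h : w ∈ generations k ℓ ∧ i < k w then φ (some ⟨⟨w, h.1⟩, ⟨i, h.2⟩⟩) else φ none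

theorem labelling_cons {k : List ℕ → ℕ} {ℓ n : ℕ} (φ : Option (Child k ℓ) → Fin n) {w : List ℕ}
    {i : ℕ} (hw : w ∈ generations k ℓ) (hi : i < k w) :
    labelling φ (i :: w) = φ (some ⟨⟨w, hw⟩, ⟨i, hi⟩⟩) := dif_pos ⟨hw, hi⟩

open Classical in
theorem le_sum_card_hasType (k : List ℕ → ℕ) (ℓ n m : ℕ) :
    n.descFactorial (Fintype.card (Child k ℓ) + 1) *
      (m.descFactorial (Fintype.card (Child k ℓ)) *
        ((n + 1).choose 2 - Fintype.card (generations k ℓ) * n) ^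
          (m - Fintype.card (Child k ℓ))) ≤
      (∏ w : generations k ℓ, (k w).factorial) * ∑ ω : Fin m → Sym2 (Fin n),
        (Finset.univ.filter fun v => HasType k ℓ (graphOf ω) v).card := by
  set Φ := Finset.univ.filter fun φ : Option (Child k ℓ) → Fin n =>
    Function.Injective φ ∧ ∀ w i j, i < j → φ (some ⟨w, i⟩) < φ (some ⟨w, j⟩) with hΦ
  have hinj : ∀ φ ∈ Φ, Set.InjOn (labelling φ) (generations k (ℓ + 1)) := by
    intro φ hφ u hu w hw h
    have hφ := (Finset.mem_filter.1 hφ).2.1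
    cases u with
    | nil =>
      cases w with
      | nil => rfl
      | cons j w =>
        obtain ⟨hw', hj⟩ := cons_mem_generations.1 hw
        rw [labelling_cons φ hw' hj] at h
        exact absurd (hφ h) (by simp)
    | cons i u =>
      obtain ⟨hu', hi⟩ := cons_mem_generations.1 hu
      rw [labelling_cons φ hu' hi] at h
      cases w with
      | nil => exact absurd (hφ h) (by simp)
      | cons j w =>
        obtain ⟨hw', hj⟩ := cons_mem_generations.1 hw
        rw [labelling_cons φ hw' hj] at h
        have := hφ h
        simp only [Option.some.injEq, Sigma.mk.injEq, Subtype.mk.injEq] at this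
        obtain ⟨rfl, h2⟩ := this
        simp only [heq_eq_eq, Fin.mk.injEq] at h2
        rw [h2]
  have hmono : ∀ φ ∈ Φ, SiblingMono k ℓ (labelling φ) := by
    intro φ hφ w hw i j hij hj
    rw [labelling_cons φ hw hj, labelling_cons φ hw (hij.trans hj)]
    exact (Finset.mem_filter.1 hφ).2.2 ⟨w, hw⟩ _ _ hij
  have hcount : ∀ ω : Fin m → Sym2 (Fin n),
      (Φ.filter fun φ => IsExploration k ℓ (graphOf ω) (labelling φ)).card ≤
        (Finset.univ.filter fun v => HasType k ℓ (graphOf ω) v).card := by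
    intro ω
    refine Finset.card_le_card_of_injOn (fun φ => φ none) ?_ ?_
    · intro φ hφ
      obtain ⟨h1, h2⟩ := Finset.mem_filter.1 hφ
      exact Finset.mem_filter.2 ⟨Finset.mem_univ _, labelling φ, rfl, h2, hmono φ h1⟩
    · intro φ hφ φ' hφ' h
      obtain ⟨h1, h2⟩ := Finset.mem_filter.1 hφ
      obtain ⟨h1', h2'⟩ := Finset.mem_filter.1 hφ'
      have hu := (exploration_unique h2 (hmono φ h1) h2' (hmono φ' h1') h).1
      funext u
      cases u with
      | none => exact h
      | some u =>
        have := (hu _ (cons_mem_generations.2 ⟨u.1.2, u.2.2⟩)).2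
        rw [labelling_cons φ u.1.2 u.2.2, labelling_cons φ' u.1.2 u.2.2] at this
        exact this
  have hper : ∀ φ ∈ Φ, _ := fun φ hφ => le_card_filter_isExploration m (hinj φ hφ)
  generalize m.descFactorial (Fintype.card (Child k ℓ)) *
    ((n + 1).choose 2 - Fintype.card (generations k ℓ) * n) ^
      (m - Fintype.card (Child k ℓ)) = N at hper ⊢
  have hsum : Φ.card * N ≤ ∑ ω : Fin m → Sym2 (Fin n),
      (Finset.univ.filter fun v => HasType k ℓ (graphOf ω) v).card := by
    rw [← smul_eq_mul]
    refine (Finset.card_nsmul_le_sum Φ _ _ hper).trans ?_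
    refine le_trans (le_of_eq ?_) (Finset.sum_le_sum fun ω _ => hcount ω)
    simp only [Finset.card_filter]
    rw [Finset.sum_comm]
  have hfac : n.descFactorial (Fintype.card (Child k ℓ) + 1) ≤
      (∏ w : generations k ℓ, (k w).factorial) * Φ.card := by
    have h := descFactorial_le_prod_factorial_mul (fun w : generations k ℓ => k w) n
    convert h
  calc n.descFactorial (Fintype.card (Child k ℓ) + 1) * N
      ≤ ((∏ w : generations k ℓ, (k w).factorial) * Φ.card) * N :=
        Nat.mul_le_mul_right _ hfac
    _ = (∏ w : generations k ℓ, (k w).factorial) * (Φ.card * N) := mul_assoc _ _ _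
    _ ≤ _ := Nat.mul_le_mul_left _ hsum

/-! ### The limit of the expectation -/

theorem tendsto_descFactorial_div_pow {x : ℕ → ℕ} {a : ℝ}
    (hx : Tendsto (fun n : ℕ => (x n : ℝ) / n) atTop (𝓝 a)) (t : ℕ) :
    Tendsto (fun n : ℕ => ((x n).descFactorial t : ℝ) / (n : ℝ) ^ t) atTop (𝓝 (a ^ t)) := by
  induction t with
  | zero => simp
  | succ t ih =>
    have h1 : Tendsto (fun n : ℕ => ((x n - t : ℕ) : ℝ) / n) atTop (𝓝 a) := by
      have h2 : Tendsto (fun n : ℕ => (x n : ℝ) / n - t / n) atTop (𝓝 (a - 0)) :=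
        hx.sub (tendsto_const_div_atTop_nhds_zero_nat _)
      rw [sub_zero] at h2
      refine tendsto_of_tendsto_of_tendsto_of_le_of_le h2 hx (fun n => ?_) fun n => ?_
      · show (x n : ℝ) / n - t / n ≤ ((x n - t : ℕ) : ℝ) / n
        rw [← sub_div]
        gcongr
        rw [sub_le_iff_le_add]
        exact_mod_cast (by omega : x n ≤ x n - t + t)
      · show ((x n - t : ℕ) : ℝ) / n ≤ (x n : ℝ) / n
        gcongr
        exact Nat.sub_le _ _
    refine (h1.mul ih).congr' ?_ |>.trans (by rw [pow_succ, mul_comm])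
    refine Eventually.of_forall fun n => ?_
    beta_reduce
    rw [Nat.descFactorial_succ, pow_succ]
    push_cast
    rw [div_mul_div_comm, mul_comm ((n : ℝ) ^ t)]

/-- The probability that independent Poisson offspring numbers agree with `k` up to generation
`ℓ`. -/
noncomputable def typeProb (c : NNReal) (k : List ℕ → ℕ) (ℓ : ℕ) : ℝ :=
  ∏ w : generations k ℓ, (poissonMeasure c).real {k w}

theorem typeProb_eq (c : NNReal) (k : List ℕ → ℕ) (ℓ : ℕ) :
    typeProb c k ℓ = (c : ℝ) ^ Fintype.card (Child k ℓ) *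
      Real.exp (-(Fintype.card (generations k ℓ) * c)) /
        ∏ w : generations k ℓ, ((k w).factorial : ℝ) := by
  unfold typeProb
  simp only [poissonMeasure_real_singleton]
  rw [Finset.prod_div_distrib, Finset.prod_mul_distrib, Finset.prod_const, ← Real.exp_nat_mul,
    Finset.card_univ, Finset.prod_pow_eq_pow_sum, Fintype.card_sigma]
  simp only [Fintype.card_fin]
  rw [mul_comm, mul_neg]

theorem tendsto_one_sub_div_pow {m : ℕ → ℕ} {c : ℝ} (s : ℕ)
    (hlim : Tendsto (fun n : ℕ => 2 * (m n : ℝ) / (n : ℝ)) atTop (𝓝 c)) :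
    Tendsto (fun n : ℕ => (1 + -(2 * s : ℝ) / (n + 1)) ^ m n) atTop
      (𝓝 (Real.exp (-(s * c)))) := by
  have h1 : Tendsto (fun n : ℕ => (1 + -(2 * s : ℝ) / (n + 1)) ^ n) atTop
      (𝓝 (Real.exp (-(2 * s)))) := by
    refine Real.tendsto_one_add_pow_exp_of_tendsto ?_
    have h2 : Tendsto (fun n : ℕ => -(2 * s : ℝ) * ((n : ℝ) / (n + 1))) atTop
        (𝓝 (-(2 * s : ℝ) * 1)) := (tendsto_natCast_div_add_atTop (1 : ℝ)).const_mul _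
    rw [mul_one] at h2
    refine h2.congr fun n => ?_
    ring
  have h2 : Tendsto (fun n : ℕ => 2 * (m n : ℝ) / (n : ℝ) / 2) atTop (𝓝 (c / 2)) :=
    hlim.div_const 2
  have h3 := h1.rpow h2 (.inl (Real.exp_pos _).ne')
  rw [← Real.exp_mul, show -(2 * (s : ℝ)) * (c / 2) = -(s * c) by ring] at h3
  refine h3.congr' ?_
  filter_upwards [eventually_gt_atTop (2 * s)] with n hn
  have hn0 : (0 : ℝ) < n := by exact_mod_cast (by omega : 0 < n)
  have hbase : 0 ≤ 1 + -(2 * s : ℝ) / (n + 1) := by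
    rw [neg_div, ← sub_eq_add_neg, sub_nonneg, div_le_one (by positivity)]
    exact_mod_cast (by omega : 2 * s ≤ n + 1)
  rw [← Real.rpow_natCast, ← Real.rpow_mul hbase, ← Real.rpow_natCast]
  congr 1
  field_simp

theorem le_average_of_count {n m t s : ℕ} {W S : ℝ} (hns : 2 * s < n) (hWpos : 0 < W)
    (hS : 0 ≤ S)
    (hcount : (n.descFactorial (t + 1) : ℝ) * (m.descFactorial t *
      (((n + 1).choose 2 - s * n : ℕ) : ℝ) ^ (m - t)) ≤ W * S) :
    (n.descFactorial (t + 1) : ℝ) / (n : ℝ) ^ (t + 1) * (m.descFactorial t / (n : ℝ) ^ t) *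
      (2 * ((n : ℝ) / (n + 1))) ^ t * (1 + -(2 * s : ℝ) / (n + 1)) ^ m / W * n ≤
      S / (Fintype.card (Sym2 (Fin n)) : ℝ) ^ m := by
  have hn0 : (0 : ℝ) < n := by exact_mod_cast (by omega : 0 < n)
  have hE : (Fintype.card (Sym2 (Fin n)) : ℝ) = n * (n + 1) / 2 := by
    rw [Sym2.card, Fintype.card_fin, Nat.cast_choose_two]
    push_cast
    ring
  set N : ℝ := n * (n + 1) / 2 with hN
  have hNpos : 0 < N := by positivity
  set q : ℝ := 1 + -(2 * s : ℝ) / (n + 1) with hq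
  have hq0 : 0 ≤ q := by
    rw [hq, neg_div, ← sub_eq_add_neg, sub_nonneg, div_le_one (by positivity)]
    exact_mod_cast (by omega : 2 * s ≤ n + 1)
  have hq1 : q ≤ 1 := by
    rw [hq, neg_div, ← sub_eq_add_neg, sub_le_self_iff]
    positivity
  have hsub : N * q ≤ (((n + 1).choose 2 - s * n : ℕ) : ℝ) := by
    have h : (((n + 1).choose 2 : ℕ) : ℝ) = N := by
      rw [Nat.cast_choose_two, hN]
      push_cast
      ring
    have h' : N * q = N - s * n := by
      rw [hN, hq]
      field_simp
      ring
    rw [h', ← h, sub_le_iff_le_add]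
    exact_mod_cast (by omega : (n + 1).choose 2 ≤ ((n + 1).choose 2 - s * n) + s * n)
  generalize (((n + 1).choose 2 - s * n : ℕ) : ℝ) = M at hsub hcount
  have hlow : (n.descFactorial (t + 1) : ℝ) * m.descFactorial t * (N ^ m * q ^ m) ≤
      N ^ t * (W * S) := by
    by_cases htm : t ≤ m
    · have e1 : N ^ m * q ^ m ≤ N ^ t * (N * q) ^ (m - t) := by
        have h1 : N ^ m = N ^ t * N ^ (m - t) := by rw [← pow_add, Nat.add_sub_cancel' htm]
        rw [h1, mul_pow, mul_assoc]
        have h2 := pow_le_pow_of_le_one hq0 hq1 (Nat.sub_le m t)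
        gcongr N ^ t * (N ^ (m - t) * ?_)
      have e2 : (N * q) ^ (m - t) ≤ M ^ (m - t) :=
        pow_le_pow_left₀ (by positivity) hsub _
      calc _ ≤ (n.descFactorial (t + 1) : ℝ) * m.descFactorial t * (N ^ t * M ^ (m - t)) := by
            refine mul_le_mul_of_nonneg_left (e1.trans ?_) (by positivity)
            exact mul_le_mul_of_nonneg_left e2 (by positivity)
        _ = N ^ t * ((n.descFactorial (t + 1) : ℝ) * (m.descFactorial t * M ^ (m - t))) := by
            ring
        _ ≤ _ := mul_le_mul_of_nonneg_left hcount (by positivity)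
    · rw [Nat.descFactorial_of_lt (not_le.1 htm), Nat.cast_zero, mul_zero, zero_mul]
      positivity
  rw [hE, le_div_iff₀ (by positivity)]
  have hNt : (2 * ((n : ℝ) / (n + 1))) ^ t * N ^ t = (n : ℝ) ^ t * (n : ℝ) ^ t := by
    rw [← mul_pow, ← mul_pow, hN]
    congr 1
    field_simp
  have hfin : N ^ t * W * ((n.descFactorial (t + 1) : ℝ) / (n : ℝ) ^ (t + 1) *
      (m.descFactorial t / (n : ℝ) ^ t) * (2 * ((n : ℝ) / (n + 1))) ^ t * q ^ m / W * n * N ^ m)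
      ≤ N ^ t * W * S := by
    refine le_trans (le_of_eq ?_) (hlow.trans (by rw [mul_assoc]))
    rw [show N ^ t * W * ((n.descFactorial (t + 1) : ℝ) / (n : ℝ) ^ (t + 1) *
        (m.descFactorial t / (n : ℝ) ^ t) * (2 * ((n : ℝ) / (n + 1))) ^ t * q ^ m / W * n * N ^ m)
        = (W / W) * ((n.descFactorial (t + 1) : ℝ) / (n : ℝ) ^ (t + 1) *
        (m.descFactorial t / (n : ℝ) ^ t) *
        ((2 * ((n : ℝ) / (n + 1))) ^ t * N ^ t) * q ^ m * n * N ^ m) by ring, hNt,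
      div_self hWpos.ne']
    field_simp
    ring
  exact le_of_mul_le_mul_left hfin (by positivity)

open Classical in
/-- For a random sequence of edges, the expected proportion of vertices of type `k` is
asymptotically at least `typeProb c k ℓ`. -/
theorem eventually_typeProb_le_average (k : List ℕ → ℕ) (ℓ : ℕ) (m : ℕ → ℕ) (c : NNReal)
    (hlim : Tendsto (fun n : ℕ => 2 * (m n : ℝ) / (n : ℝ)) atTop (𝓝 (c : ℝ))) (η : ℝ)
    (hη : 0 < η) :
    ∀ᶠ n : ℕ in atTop, (typeProb c k ℓ - η) * n ≤
      (∑ ω : Fin (m n) → Sym2 (Fin n),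
        ((Finset.univ.filter fun v => HasType k ℓ (graphOf ω) v).card : ℝ)) /
          (Fintype.card (Sym2 (Fin n)) : ℝ) ^ m n := by
  set t := Fintype.card (Child k ℓ) with ht
  set s := Fintype.card (generations k ℓ) with hs
  set W : ℝ := ∏ w : generations k ℓ, ((k w).factorial : ℝ) with hW
  have hWpos : 0 < W := Finset.prod_pos fun w _ => by positivity
  have hid : Tendsto (fun n : ℕ => (n : ℝ) / n) atTop (𝓝 1) := by
    refine tendsto_const_nhds.congr' ?_
    filter_upwards [eventually_gt_atTop 0] with n hn
    rw [div_self (by exact_mod_cast hn.ne')]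
  have hmn : Tendsto (fun n : ℕ => (m n : ℝ) / n) atTop (𝓝 (c / 2)) :=
    (hlim.div_const 2).congr fun n => by ring
  have h1 := tendsto_descFactorial_div_pow hid (t + 1)
  have h2 := tendsto_descFactorial_div_pow hmn t
  have h3 : Tendsto (fun n : ℕ => (2 * ((n : ℝ) / (n + 1))) ^ t) atTop (𝓝 ((2 * 1) ^ t)) :=
    ((tendsto_natCast_div_add_atTop (1 : ℝ)).const_mul 2).pow t
  have h4 := tendsto_one_sub_div_pow s hlim
  have h5 := (((h1.mul h2).mul h3).mul h4).div_const W
  have hval : 1 ^ (t + 1) * ((c : ℝ) / 2) ^ t * (2 * 1) ^ t * Real.exp (-(s * c)) / W =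
      typeProb c k ℓ := by
    rw [typeProb_eq, one_pow, one_mul, ← mul_pow]
    congr 3
    ring
  rw [hval] at h5
  have h6 := h5.eventually_const_lt (sub_lt_self _ hη)
  filter_upwards [h6, eventually_gt_atTop (2 * s)] with n hn hns
  have hn0 : (0 : ℝ) < n := by exact_mod_cast (by omega : 0 < n)
  have hcount := le_sum_card_hasType k ℓ n (m n)
  rw [← ht, ← hs] at hcount
  have hcount' := (Nat.cast_le (α := ℝ)).2 hcount
  push_cast at hcount'
  refine le_trans ?_ (le_average_of_count hns hWpos
    (Finset.sum_nonneg fun _ _ => Nat.cast_nonneg _) hcount')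
  gcongr

/-! ### From sequences of edges to random planar graphs -/

open Classical in
/-- Every graph with `m` edges comes from `m!` sequences. -/
theorem card_filter_graphOf_eq {n m : ℕ} (G : SimpleGraph (Fin n)) (hG : G.edgeSet.ncard = m) :
    (Finset.univ.filter fun ω : Fin m → Sym2 (Fin n) => graphOf ω = G).card = m.factorial := by
  have hcard : Fintype.card (Fin m ≃ G.edgeSet) = m.factorial := by
    have h : Fintype.card (Fin m) = Fintype.card G.edgeSet := by
      rw [← Nat.card_eq_fintype_card (α := G.edgeSet), Nat.card_coe_set_eq, hG, Fintype.card_fin]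
    rw [Fintype.card_equiv (Fintype.equivOfCardEq h), Fintype.card_fin]
  rw [← hcard, ← Finset.card_univ]
  symm
  refine Finset.card_bij (fun σ _ i => (σ i : Sym2 (Fin n))) ?_ ?_ ?_
  · intro σ _
    refine Finset.mem_filter.2 ⟨Finset.mem_univ _, ?_⟩
    have : Set.range (fun i => (σ i : Sym2 (Fin n))) = G.edgeSet := by
      rw [show (fun i => (σ i : Sym2 (Fin n))) = Subtype.val ∘ σ from rfl, Set.range_comp,
        σ.surjective.range_eq]
      simp
    rw [graphOf, this, SimpleGraph.fromEdgeSet_edgeSet]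
  · intro σ _ τ _ h
    exact Equiv.ext fun i => Subtype.ext (congrFun h i)
  · intro ω hω
    have hω := (Finset.mem_filter.1 hω).2
    have hsub : G.edgeSet ⊆ Set.range ω := by
      rw [← hω, graphOf, SimpleGraph.edgeSet_fromEdgeSet]
      exact Set.sdiff_subset
    have hle : (Set.range ω).ncard ≤ m := by
      rw [← Set.image_univ]
      refine (Set.ncard_image_le Set.finite_univ).trans ?_
      simp [Set.ncard_univ]
    have heq : G.edgeSet = Set.range ω :=
      Set.eq_of_subset_of_ncard_le hsub (by rw [hG]; exact hle) (Set.toFinite _)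
    have hmem : ∀ i, ω i ∈ G.edgeSet := fun i => heq ▸ Set.mem_range_self i
    have hsurj : Function.Surjective fun i => (⟨ω i, hmem i⟩ : G.edgeSet) := by
      rintro ⟨e, he⟩
      obtain ⟨i, rfl⟩ := hsub he
      exact ⟨i, rfl⟩
    have hbij : Function.Bijective fun i => (⟨ω i, hmem i⟩ : G.edgeSet) := by
      rw [Fintype.bijective_iff_surjective_and_card]
      refine ⟨hsurj, ?_⟩
      rw [← Nat.card_eq_fintype_card (α := G.edgeSet), Nat.card_coe_set_eq, hG, Fintype.card_fin]
    exact ⟨Equiv.ofBijective _ hbij, Finset.mem_univ _, rfl⟩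

open Classical in
/-- The planar graphs with `m` edges on `Fin n` as a finite set. -/
noncomputable def planarFinset (n m : ℕ) : Finset (SimpleGraph (Fin n)) :=
  Finset.univ.filter fun G => G ∈ planarClass n m

open Classical in
theorem sum_filter_graphOf (n m : ℕ) (f : SimpleGraph (Fin n) → ℝ) :
    ∑ ω : Fin m → Sym2 (Fin n) with graphOf ω ∈ planarFinset n m, f (graphOf ω) =
      m.factorial * ∑ G ∈ planarFinset n m, f G := by
  rw [← Finset.sum_fiberwise_of_maps_to (t := planarFinset n m) (g := graphOf)
    fun ω hω => (Finset.mem_filter.1 hω).2, Finset.mul_sum]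
  refine Finset.sum_congr rfl fun G hG => ?_
  have h1 : (Finset.univ.filter fun ω : Fin m → Sym2 (Fin n) =>
      graphOf ω ∈ planarFinset n m).filter (fun ω => graphOf ω = G) =
      Finset.univ.filter fun ω => graphOf ω = G := by
    ext ω
    simp only [Finset.mem_filter, Finset.mem_univ, true_and, and_iff_right_iff_imp]
    rintro rfl
    exact hG
  rw [h1, Finset.sum_congr rfl fun ω hω => congrArg f (Finset.mem_filter.1 hω).2,
    Finset.sum_const, card_filter_graphOf_eq G (Finset.mem_filter.1 hG).2.2, nsmul_eq_mul]

open Classical in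
theorem exists_abs_card_hasType_sub_le (k : List ℕ →₀ ℕ) (ℓ : ℕ) :
    ∃ L : ℝ, 1 ≤ L ∧ ∀ (n m : ℕ) (ω : Fin m → Sym2 (Fin n)) (i : Fin m) (e : Sym2 (Fin n)),
      |((Finset.univ.filter fun v => HasType k ℓ (graphOf (Function.update ω i e)) v).card : ℝ) -
        (Finset.univ.filter fun v => HasType k ℓ (graphOf ω) v).card| ≤ L := by
  obtain ⟨L, hL⟩ := exists_card_hasType_le k ℓ
  refine ⟨L + 1, by simp, fun n m ω i e => ?_⟩
  have hB : ((ω i).toFinset ∪ e.toFinset).card ≤ 4 := by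
    refine (Finset.card_union_le _ _).trans ?_
    have h2 : ∀ z : Sym2 (Fin n), z.toFinset.card ≤ 2 := fun z => by
      rw [Sym2.card_toFinset]
      split_ifs <;> simp
    have := h2 (ω i)
    have := h2 e
    omega
  have hadj : ∀ a ∉ (ω i).toFinset ∪ e.toFinset, ∀ z,
      (graphOf (Function.update ω i e)).Adj a z ↔ (graphOf ω).Adj a z := by
    intro a ha z
    simp only [Finset.mem_union, Sym2.mem_toFinset, not_or] at ha
    simp only [graphOf, SimpleGraph.fromEdgeSet_adj]
    refine and_congr_left fun _ => ⟨?_, ?_⟩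
    · rintro ⟨j, hj⟩
      by_cases hji : j = i
      · subst hji
        rw [Function.update_self] at hj
        exact absurd (by rw [hj]; exact Sym2.mem_mk_left a z) ha.2
      · rw [Function.update_of_ne hji] at hj
        exact ⟨j, hj⟩
    · rintro ⟨j, hj⟩
      by_cases hji : j = i
      · subst hji
        exact absurd (by rw [hj]; exact Sym2.mem_mk_left a z) ha.1
      · exact ⟨j, by rw [Function.update_of_ne hji]; exact hj⟩
  have h1 := (Nat.cast_le (α := ℝ)).2 (hL n _ _ _ hB hadj)
  have h2 := (Nat.cast_le (α := ℝ)).2 (hL n _ _ _ hB fun a ha z => (hadj a ha z).symm)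
  push_cast at h1 h2
  rw [abs_le]
  constructor <;> linarith

open Classical in
/-- In a random planar graph, the expected proportion of vertices of type `k` is asymptotically at
least `typeProb c k ℓ`. -/
theorem eventually_typeProb_le_planar (k : List ℕ →₀ ℕ) (ℓ : ℕ) (m : ℕ → ℕ) (c : NNReal)
    (hc : c ≤ 1) (hlim : Tendsto (fun n : ℕ => 2 * (m n : ℝ) / (n : ℝ)) atTop (𝓝 (c : ℝ)))
    (η : ℝ) (hη : 0 < η) :
    ∀ᶠ n : ℕ in atTop, (planarFinset n (m n)).Nonempty ∧ typeProb c k ℓ - η ≤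
      (∑ G ∈ planarFinset n (m n), ((Finset.univ.filter fun v => HasType k ℓ G v).card : ℝ)) /
        ((planarFinset n (m n)).card * n) := by
  obtain ⟨L, hL1, hL⟩ := exists_abs_card_hasType_sub_le k ℓ
  have hc1 : (c : ℝ) ≤ 1 := by exact_mod_cast hc
  obtain ⟨s, hs, hsL, hsη⟩ : ∃ s : ℝ, 0 < s ∧ s * L ≤ 1 ∧ s * L ^ 2 ≤ η / 3 := by
    refine ⟨min 1 (η / 3) / L ^ 2, by positivity, ?_, ?_⟩
    · rw [div_mul_eq_mul_div, div_le_one (by positivity)]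
      have : min 1 (η / 3) ≤ 1 := min_le_left _ _
      nlinarith
    · rw [div_mul_cancel₀ _ (by positivity)]
      exact min_le_right _ _
  have hlt : ∀ᶠ n : ℕ in atTop, 2 * (m n : ℝ) / (n : ℝ) < 2 :=
    hlim.eventually_lt_const (by linarith)
  filter_upwards [eventually_typeProb_le_average k ℓ m c hlim (η / 3) (by positivity),
    eventually_card_le_exp_mul_card_forests m c hc1 hlim (s * (η / 3)) (by positivity), hlt,
    eventually_gt_atTop 0] with n h1 h2 h3 hn
  have hn0 : (0 : ℝ) < n := by exact_mod_cast hn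
  have hmn : (m n : ℝ) ≤ n := by
    rw [div_lt_iff₀ hn0] at h3
    linarith
  have hcardE : Fintype.card (Sym2 (Fin n)) = (n + 1).choose 2 := by
    rw [Sym2.card, Fintype.card_fin]
  have : Nonempty (Sym2 (Fin n)) := ⟨s(⟨0, hn⟩, ⟨0, hn⟩)⟩
  have hsubset : forests n (m n) ⊆ planarFinset n (m n) := by
    intro G hG
    obtain ⟨hG1, hG2⟩ := mem_forests.1 hG
    exact Finset.mem_filter.2 ⟨Finset.mem_univ _, isPlanar_of_isAcyclic G hG1, hG2⟩
  have hle : ((forests n (m n)).card : ℝ) ≤ (planarFinset n (m n)).card := by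
    exact_mod_cast Finset.card_le_card hsubset
  set A : Finset (Fin (m n) → Sym2 (Fin n)) :=
    Finset.univ.filter fun ω => graphOf ω ∈ planarFinset n (m n) with hA
  have hAcard : (A.card : ℝ) = (m n).factorial * (planarFinset n (m n)).card := by
    have := sum_filter_graphOf n (m n) fun _ => 1
    simpa using this
  rw [← hcardE] at h2
  have hK : (Fintype.card (Sym2 (Fin n)) : ℝ) ^ m n ≤
      Real.exp (s * (η / 3) * n) * A.card := by
    rw [hAcard]
    refine h2.trans ?_
    gcongr
  have hEpos : (0 : ℝ) < (Fintype.card (Sym2 (Fin n)) : ℝ) ^ m n := by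
    have : (0 : ℝ) < Fintype.card (Sym2 (Fin n)) := by exact_mod_cast Fintype.card_pos
    positivity
  have hApos : (0 : ℝ) < A.card := by
    by_contra h
    have : (A.card : ℝ) = 0 := le_antisymm (not_lt.1 h) (Nat.cast_nonneg _)
    rw [this, mul_zero] at hK
    linarith
  have hAne : A.Nonempty := Finset.card_pos.1 (by exact_mod_cast hApos)
  have hPne : (planarFinset n (m n)).Nonempty := by
    obtain ⟨ω, hω⟩ := hAne
    exact ⟨_, (Finset.mem_filter.1 hω).2⟩
  refine ⟨hPne, ?_⟩
  have hP0 : (0 : ℝ) < (planarFinset n (m n)).card := by exact_mod_cast hPne.card_pos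
  have h4 := average_ge_of_lipschitz L s _ hs hsL (m n)
    (fun ω => ((Finset.univ.filter fun v => HasType k ℓ (graphOf ω) v).card : ℝ))
    (hL n (m n)) A hAne hK
  have h5 := sum_filter_graphOf n (m n)
    fun G => ((Finset.univ.filter fun v => HasType k ℓ G v).card : ℝ)
  rw [h5, hAcard, mul_div_mul_left _ _ (by positivity)] at h4
  rw [← div_div, le_div_iff₀ hn0]
  refine le_trans ?_ h4
  have e1 : s * L ^ 2 * m n ≤ η / 3 * n := by gcongr
  have e2 : s * (η / 3) * n / s = η / 3 * n := by field_simp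
  rw [e2]
  linarith

/-! ### The law of the random planar graph -/

instance {n : ℕ} : MeasurableSingletonClass (SimpleGraph (Fin n)) where
  measurableSet_singleton G := by
    have h : ({G} : Set (SimpleGraph (Fin n))) = ⋂ u, ⋂ v, {G' | G'.Adj u v ↔ G.Adj u v} := by
      ext G'
      simp only [Set.mem_singleton_iff, Set.mem_iInter, Set.mem_ofPred_eq]
      exact ⟨fun h => by simp [h], fun h => SimpleGraph.ext (by ext u v; exact h u v)⟩
    rw [h]
    refine MeasurableSet.iInter fun u => MeasurableSet.iInter fun v => ?_
    have hm : Measurable fun G' : SimpleGraph (Fin n) => G'.Adj u v :=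
      SimpleGraph.measurable_iff_adj.1 measurable_id u v
    exact measurableSet_setOfPred.2 (hm.iff measurable_const)

theorem coe_planarFinset (n m : ℕ) :
    (planarFinset n m : Set (SimpleGraph (Fin n))) = planarClass n m := by
  ext G
  simp [planarFinset]

theorem isProbabilityMeasure_planarLaw {n m : ℕ} (hn : 0 < n) (h : (planarFinset n m).Nonempty) :
    IsProbabilityMeasure (planarLaw n m) := by
  have : Nonempty (Fin n) := ⟨⟨0, hn⟩⟩
  have := isProbabilityMeasure_uniformOn (s := planarClass n m) (Set.toFinite _)
    (by rw [← coe_planarFinset]; exact h)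
  unfold planarLaw
  infer_instance

open Classical in
/-- The probability of an event for a uniform planar graph with a uniform root is the average
proportion of roots. -/
theorem planarLaw_real_setOf {n m : ℕ} (hn : 0 < n) (h : (planarFinset n m).Nonempty)
    (p : SimpleGraph (Fin n) → Fin n → Prop) :
    (planarLaw n m).real {q | p q.1 q.2} =
      (∑ G ∈ planarFinset n m, ((Finset.univ.filter fun v => p G v).card : ℝ)) /
        ((planarFinset n m).card * n) := by
  have hsing : ∀ G ∈ planarFinset n m, ∀ v, (planarLaw n m).real {(G, v)} =
      1 / ((planarFinset n m).card * n) := by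
    intro G hG v
    rw [measureReal_def, ← Set.singleton_prod_singleton, planarLaw, Measure.prod_prod,
      ← coe_planarFinset, ← Finset.coe_univ, ← Finset.coe_singleton, ← Finset.coe_singleton,
      uniformOn_apply_finset, uniformOn_apply_finset, ENNReal.toReal_mul,
      Finset.inter_singleton_of_mem hG, Finset.inter_singleton_of_mem (Finset.mem_univ v)]
    simp
    ring
  have hprob := isProbabilityMeasure_planarLaw hn h
  have hzero : (planarLaw n m).real {q | q.1 ∉ planarFinset n m} = 0 := by
    have h1 : {q : SimpleGraph (Fin n) × Fin n | q.1 ∉ planarFinset n m} =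
        (planarClass n m)ᶜ ×ˢ Set.univ := by
      ext q
      simp [← coe_planarFinset]
    rw [measureReal_def, h1, planarLaw, Measure.prod_prod,
      (uniformOn_eq_zero_iff (Set.toFinite _)).2 (by simp), zero_mul, ENNReal.toReal_zero]
  let S : Finset (SimpleGraph (Fin n) × Fin n) :=
    (planarFinset n m ×ˢ Finset.univ).filter fun q => p q.1 q.2
  have hS : (planarLaw n m).real {q | p q.1 q.2} = (planarLaw n m).real (S : Set _) := by
    apply le_antisymm
    · have hsub : {q : SimpleGraph (Fin n) × Fin n | p q.1 q.2} ⊆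
          (S : Set _) ∪ {q | q.1 ∉ planarFinset n m} := by
        intro q hq
        by_cases hq' : q.1 ∈ planarFinset n m
        · exact .inl (by simpa [S] using ⟨hq', hq⟩)
        · exact .inr hq'
      refine (measureReal_mono hsub).trans ((measureReal_union_le _ _).trans ?_)
      rw [hzero, add_zero]
    · refine measureReal_mono fun q hq => ?_
      exact (Finset.mem_filter.1 (Finset.mem_coe.1 hq)).2
  rw [hS, ← sum_measureReal_singleton]
  rw [Finset.sum_congr rfl fun q hq =>
    hsing q.1 (Finset.mem_product.1 (Finset.mem_filter.1 hq).1).1 q.2]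
  rw [Finset.sum_const, nsmul_eq_mul, mul_one_div]
  congr 1
  rw [Finset.card_filter, Finset.sum_product]
  push_cast
  refine Finset.sum_congr rfl fun G _ => ?_
  rw [Finset.card_filter]
  push_cast
  rfl

/-! ### The law of the Galton–Watson tree -/

/-- The offspring numbers which agree with `k` up to generation `ℓ`. -/
def typeEvent (ℓ : ℕ) (k : List ℕ → ℕ) : Set (List ℕ → ℕ) :=
  {X | ∀ w ∈ generations k ℓ, X w = k w}

theorem typeEvent_eq_pi (ℓ : ℕ) (k : List ℕ → ℕ) :
    typeEvent ℓ k = Set.pi ((finite_generations k ℓ).toFinset : Set (List ℕ)) fun w => {k w} := by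
  ext X
  simp [typeEvent, Set.mem_pi]

theorem measurableSet_typeEvent (ℓ : ℕ) (k : List ℕ → ℕ) : MeasurableSet (typeEvent ℓ k) := by
  rw [typeEvent_eq_pi]
  exact MeasurableSet.pi (Finset.countable_toSet _) fun _ _ => measurableSet_singleton _

instance (c : NNReal) : IsProbabilityMeasure (offspringLaw c) := by
  unfold offspringLaw
  infer_instance

theorem offspringLaw_real_typeEvent (c : NNReal) (ℓ : ℕ) (k : List ℕ → ℕ) :
    (offspringLaw c).real (typeEvent ℓ k) = typeProb c k ℓ := by
  rw [measureReal_def, typeEvent_eq_pi, offspringLaw,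
    Measure.infinitePi_pi _ fun _ _ => measurableSet_singleton _, ENNReal.toReal_prod, typeProb]
  rw [← Finset.prod_coe_sort]
  refine Fintype.prod_equiv (Equiv.subtypeEquivRight fun w => by simp) _ _ fun w => ?_
  rfl

theorem generations_congr {k X : List ℕ → ℕ} {ℓ : ℕ} (h : X ∈ typeEvent ℓ k) :
    generations X ℓ = generations k ℓ := by
  ext w
  refine and_congr_left fun hw => isIndividual_congr h w (by omega)

theorem disjoint_typeEvent {k k' : List ℕ → ℕ} {ℓ : ℕ} (hk : IsShape ℓ k) (hk' : IsShape ℓ k')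
    (hne : k ≠ k') : Disjoint (typeEvent ℓ k) (typeEvent ℓ k') := by
  rw [Set.disjoint_left]
  intro X h h'
  have hg := (generations_congr h).symm.trans (generations_congr h')
  refine hne (funext fun w => ?_)
  by_cases hw : w ∈ generations k ℓ
  · rw [← h w hw, ← h' w (hg ▸ hw)]
  · have h1 : k w = 0 := by
      by_contra h0
      exact hw (hk w h0)
    have h2 : k' w = 0 := by
      by_contra h0
      exact hw (hg ▸ hk' w h0)
    rw [h1, h2]

open Classical in
/-- Forgetting the later generations of a family tree leaves one of countably many shapes. -/
theorem exists_shape (ℓ : ℕ) (X : List ℕ → ℕ) :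
    ∃ k : List ℕ →₀ ℕ, IsShape ℓ k ∧ X ∈ typeEvent ℓ k := by
  let k : List ℕ →₀ ℕ := Finsupp.onFinset (finite_generations X ℓ).toFinset
    (fun w => if w ∈ generations X ℓ then X w else 0) (by
      intro w hw
      rw [Set.Finite.mem_toFinset]
      by_contra h
      exact hw (if_neg h))
  have hk : ∀ w, k w = if w ∈ generations X ℓ then X w else 0 := fun w => rfl
  have h1 : (k : List ℕ → ℕ) ∈ typeEvent ℓ X := fun w hw => by rw [hk, if_pos hw]
  have hg := generations_congr h1
  refine ⟨k, fun w hw => ?_, fun w hw => ?_⟩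
  · rw [hg]
    by_contra h
    exact hw (by rw [hk, if_neg h])
  · rw [hg] at hw
    exact (h1 w hw).symm

/-! ### Convergence -/

/-- The mass of a countable union of disjoint sets is exhausted by finitely many of them. -/
theorem exists_finset_sum_gt {Ω ι : Type*} [MeasurableSpace Ω] [Countable ι] (μ : Measure Ω)
    [IsProbabilityMeasure μ] (C : ι → Set Ω) (hC : ∀ i, MeasurableSet (C i))
    (hd : Pairwise fun i j => Disjoint (C i) (C j)) (T : Set ι) (ε : ℝ) (hε : 0 < ε) :
    ∃ F : Finset ι, ↑F ⊆ T ∧ μ.real (⋃ i ∈ T, C i) - ε < ∑ i ∈ F, μ.real (C i) := by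
  have h1 : μ (⋃ i ∈ T, C i) = ∑' i : T, μ (C i) := by
    rw [Set.biUnion_eq_iUnion]
    exact measure_iUnion (fun i j hij => hd fun h => hij (Subtype.ext h)) fun i => hC i
  have h2 : HasSum (fun i : T => μ.real (C i)) (μ.real (⋃ i ∈ T, C i)) := by
    rw [measureReal_def, h1, ENNReal.tsum_toReal_eq fun _ => measure_ne_top μ _]
    exact ENNReal.hasSum_toReal (h1 ▸ measure_ne_top μ _)
  obtain ⟨F, hF⟩ := (h2.eventually_const_lt (sub_lt_self _ hε)).exists
  refine ⟨F.map ⟨Subtype.val, Subtype.val_injective⟩, ?_, ?_⟩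
  · intro i hi
    simp only [Finset.coe_map, Function.Embedding.coeFn_mk, Set.mem_image] at hi
    obtain ⟨j, -, rfl⟩ := hi
    exact j.2
  · rw [Finset.sum_map]
    exact hF

theorem sum_planarLaw_hasType_le {n m ℓ : ℕ} [IsProbabilityMeasure (planarLaw n m)]
    (S : Set (SimpleGraph (Fin n) × Fin n)) (F : Finset {k : List ℕ →₀ ℕ // IsShape ℓ k})
    (hF : ∀ k ∈ F, ∀ G v, HasType k.1 ℓ G v → (G, v) ∈ S) :
    ∑ k ∈ F, (planarLaw n m).real {q | HasType k.1 ℓ q.1 q.2} ≤ (planarLaw n m).real S := by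
  rw [← measureReal_biUnion_finset]
  · refine measureReal_mono ?_
    intro q hq
    simp only [Set.mem_iUnion] at hq
    obtain ⟨k, hk, hq⟩ := hq
    exact hF k hk q.1 q.2 hq
  · intro k _ k' _ hne
    rw [Function.onFun, Set.disjoint_left]
    intro q hq hq'
    exact hne (Subtype.ext (DFunLike.coe_injective (HasType.unique k.2 k'.2 hq hq')))
  · intro k _
    exact (Set.toFinite _).measurableSet

/-- Lower bounds for the limits of the probabilities of all types, whose limits sum to one, give
the convergence of the probability of every event that depends on the type. -/
theorem tendsto_ball_isomorphic (m : ℕ → ℕ) (c : NNReal) (hc : c ≤ 1)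
    (hlim : Tendsto (fun n : ℕ => 2 * (m n : ℝ) / (n : ℝ)) atTop (𝓝 (c : ℝ)))
    (H : RootedGraph) (ℓ : ℕ) :
    Tendsto (fun n => (planarLaw n (m n)).real {q | ((rootedOfPair n q).ball ℓ).Isomorphic H}) atTop
      (𝓝 ((offspringLaw c).real {X | ((familyTree X).ball ℓ).Isomorphic H})) := by
  let ι := {k : List ℕ →₀ ℕ // IsShape ℓ k}
  let C : ι → Set (List ℕ → ℕ) := fun k => typeEvent ℓ k.1
  have hCm : ∀ k, MeasurableSet (C k) := fun k => measurableSet_typeEvent ℓ k.1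
  have hCd : Pairwise fun k k' => Disjoint (C k) (C k') := fun k k' hne =>
    disjoint_typeEvent k.2 k'.2 fun h => hne (Subtype.ext (DFunLike.coe_injective h))
  have hself : ∀ k : ι, (k.1 : List ℕ → ℕ) ∈ C k := fun k w _ => rfl
  have hiso : ∀ (k : ι) (X), X ∈ C k →
      ((familyTree X).ball ℓ).Isomorphic ((familyTree k.1).ball ℓ) := by
    intro k X hX
    obtain ⟨ψ, h0, hψ⟩ := exists_isExploration_familyTree hX
    obtain ⟨ψ', h0', hψ'⟩ := exists_isExploration_familyTree (hself k)
    have h := hψ.ball_isomorphic hψ'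
    rw [h0, h0'] at h
    exact h
  let T : Set ι := {k | ((familyTree k.1).ball ℓ).Isomorphic H}
  have hT : {X | ((familyTree X).ball ℓ).Isomorphic H} = ⋃ k ∈ T, C k := by
    ext X
    simp only [Set.mem_ofPred_eq, Set.mem_iUnion, exists_prop]
    constructor
    · intro hX
      obtain ⟨k, hk, hXk⟩ := exists_shape ℓ X
      exact ⟨⟨k, hk⟩, (hiso ⟨k, hk⟩ X hXk).symm.trans hX, hXk⟩
    · rintro ⟨k, hk, hXk⟩
      exact (hiso k X hXk).trans hk
  have hTc : {X | ((familyTree X).ball ℓ).Isomorphic H}ᶜ = ⋃ k ∈ Tᶜ, C k := by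
    ext X
    simp only [Set.mem_compl_iff, Set.mem_ofPred_eq, Set.mem_iUnion, exists_prop]
    constructor
    · intro hX
      obtain ⟨k, hk, hXk⟩ := exists_shape ℓ X
      exact ⟨⟨k, hk⟩, fun h => hX ((hiso ⟨k, hk⟩ X hXk).trans h), hXk⟩
    · rintro ⟨k, hk, hXk⟩ hX
      exact hk ((hiso k X hXk).symm.trans hX)
  have hmeas : MeasurableSet {X | ((familyTree X).ball ℓ).Isomorphic H} := by
    rw [hT]
    exact MeasurableSet.biUnion (Set.to_countable T) fun k _ => hCm k
  set a := (offspringLaw c).real {X | ((familyTree X).ball ℓ).Isomorphic H} with ha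
  have hac : (offspringLaw c).real {X | ((familyTree X).ball ℓ).Isomorphic H}ᶜ = 1 - a :=
    probReal_compl_eq_one_sub hmeas
  -- the lower bound for an event which contains the types in a finite set
  have hlow : ∀ (F : Finset ι) (ε : ℝ), 0 < ε → ∀ᶠ n in atTop,
      IsProbabilityMeasure (planarLaw n (m n)) ∧
      ∑ k ∈ F, (offspringLaw c).real (C k) - ε ≤
        ∑ k ∈ F, (planarLaw n (m n)).real {q | HasType k.1 ℓ q.1 q.2} := by
    intro F ε hε
    have h1 : ∀ k : ι, ∀ᶠ n in atTop, IsProbabilityMeasure (planarLaw n (m n)) ∧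
        (offspringLaw c).real (C k) - ε / (F.card + 1) ≤
          (planarLaw n (m n)).real {q | HasType k.1 ℓ q.1 q.2} := by
      intro k
      filter_upwards [eventually_typeProb_le_planar k.1 ℓ m c hc hlim (ε / (F.card + 1))
        (by positivity), eventually_gt_atTop 0] with n hn hn0
      refine ⟨isProbabilityMeasure_planarLaw hn0 hn.1, ?_⟩
      rw [planarLaw_real_setOf hn0 hn.1, offspringLaw_real_typeEvent]
      exact hn.2
    have h2 : ∀ᶠ n in atTop, ∀ k ∈ F, (offspringLaw c).real (C k) - ε / (F.card + 1) ≤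
        (planarLaw n (m n)).real {q | HasType k.1 ℓ q.1 q.2} :=
      (Filter.eventually_all_finset F).2 fun k _ => (h1 k).mono fun n hn => hn.2
    obtain ⟨k1, hk1, -⟩ := exists_shape ℓ fun _ => 0
    filter_upwards [h2, h1 ⟨k1, hk1⟩] with n hn hn'
    refine ⟨hn'.1, le_trans ?_ (Finset.sum_le_sum hn)⟩
    rw [Finset.sum_sub_distrib, Finset.sum_const, nsmul_eq_mul]
    gcongr
    rw [mul_div_assoc', div_le_iff₀ (by positivity)]
    nlinarith
  rw [Metric.tendsto_atTop']
  intro ε hε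
  obtain ⟨F, hFT, hF⟩ := exists_finset_sum_gt (offspringLaw c) C hCm hCd T (ε / 2) (by positivity)
  obtain ⟨F', hFT', hF'⟩ :=
    exists_finset_sum_gt (offspringLaw c) C hCm hCd Tᶜ (ε / 2) (by positivity)
  rw [← hT] at hF
  rw [← hTc, hac] at hF'
  have hev := (hlow F (ε / 2) (by positivity)).and (hlow F' (ε / 2) (by positivity))
  obtain ⟨N, hN⟩ := (hev.and (eventually_gt_atTop 0)).exists_forall_of_atTop
  refine ⟨N, fun n hn => ?_⟩
  obtain ⟨⟨⟨hprob, h1⟩, -, h2⟩, -⟩ := hN n hn.le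
  set S := {q | ((rootedOfPair n q).ball ℓ).Isomorphic H} with hS
  have h3 : ∑ k ∈ F, (planarLaw n (m n)).real {q | HasType k.1 ℓ q.1 q.2} ≤
      (planarLaw n (m n)).real S :=
    sum_planarLaw_hasType_le S F fun k hk G v hv =>
      (hv.ball_isomorphic (hself k)).trans (hFT hk)
  have h4 : ∑ k ∈ F', (planarLaw n (m n)).real {q | HasType k.1 ℓ q.1 q.2} ≤
      (planarLaw n (m n)).real Sᶜ :=
    sum_planarLaw_hasType_le Sᶜ F' fun k hk G v hv hH =>
      hFT' hk ((hv.ball_isomorphic (hself k)).symm.trans hH)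
  rw [probReal_compl_eq_one_sub (Set.toFinite S).measurableSet] at h4
  rw [Real.dist_eq, abs_lt]
  constructor <;> linarith

end LocalPlanar

theorem theorem1p3 (m : ℕ → ℕ) (c : NNReal) (hc : c ≤ 1)
    (hm : ∃ C : ℝ, ∀ᶠ n : ℕ in atTop, (m n : ℝ) ≤ (n : ℝ) / 2 + C * (n : ℝ) ^ (2 / 3 : ℝ))
    (hlim : Tendsto (fun n : ℕ => 2 * (m n : ℝ) / (n : ℝ)) atTop (𝓝 (c : ℝ))) :
    LocalPlanar.IsLocalWeakLimit
      (fun n => LocalPlanar.planarLaw n (m n)) LocalPlanar.rootedOfPair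
      (LocalPlanar.offspringLaw c) LocalPlanar.familyTree := by
  intro H ℓ _
  exact LocalPlanar.tendsto_ball_isomorphic m c hc hlim H ℓ
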